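/- Let $X$ be a proper metric space. Two subsets $A,B\subseteq X$ are called close, written $A\curlywedge B$, if for some $R\ge 0$ there is an unbounded sequence $(a_i,b_i)$ in $A\times B$ with $d(a_i,b_i)\le R$ for all $i$; otherwise we write $A\not\curlywedge B$. Write $U^c=X\setminus U$. *The site $X_{ct}$.* A finite (possibly empty) family $U_1,\dots,U_n$ of subsets of $U\subseteq X$ is a coarse cover of $U$ if for every $E\subseteq U\times U$ with $\sup_{(x,y)\in E}d(x,y)<\infty$ the set $\bigcap_i E[U\setminus U_i]$ (an intersection of subsets of $U$) is bounded, where $E[B]=\{x : \exists y\in B,\ (x,y)\in E\}$. The poset of subsets of $X$ with the coarse covers is the site $X_{ct}$. "Sheaf" means sheaf of abelian groups. *The Higson corona.* Choose a Delone set $S\subseteq X$ (uniformly discrete and relatively dense) and let $\hat S$ be the set of nonprincipal ultrafilters on $S$, with the topology given by the Kuratowski closure operator that sends $\pi\subseteq\hat S$ to the set of all $\mathcal F$ such that $A\curlywedge B$ whenever $A\in\mathcal F$ and $B\subseteq S$ belongs to every member of $\pi$. The Higson corona $\nu(X)$ is the quotient space of $\hat S$ by the relation: $\mathcal F\sim\mathcal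 G$ iff $A\curlywedge B$ for all $A\in\mathcal F$, $B\in\mathcal G$. For $A\subseteq X$ let $A^{\nu}\subseteq\nu(X)$ be the closed set of all classes $[\mathcal F]$ such that $B\curlywedge A$ for all $B\in\mathcal F$ (the intersection of $\nu(X)$ with the closure of $A$ in the Higson compactification), and let $O_U=\nu(X)\setminus (U^c)^\nu$ for $U\subseteq X$; these are the basic open sets. *The functors.* For a sheaf $F$ on $X_{ct}$ let $F^\nu$ be the presheaf on $\nu(X)$ with $F^\nu(O_U)=\varprojlim_{A\not\curlywedge U^c}F(A)$, extended to all open sets as the limit over the basic open subsets. For a sheaf $G$ on $\nu(X)$ let $\hat G$ be the presheaf on $X_{ct}$ with $\hat G(A)=\varinjlim_{A\not\curlywedge U^c}G(O_U)$. Both constructions are functorial in the evident way. A sheaf $F$ on $X_{ct}$ is reflective if for every $A\subseteq X$ the canonical map $\varinjlim_{A\not\curlywedge U^c}F(U)\to F(A)$ is an isomorphism (here $A\setminus U$ is bounded, and $F(U)\to F(A)$ is the restriction to $A\cap U$ followed by the inverse of the isomorphism $F(A)\to F(A\cap U)$). **Theorem.** For every choice of the Delone set $S$: 1. $F^\nu$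 is a sheaf on $\nu(X)$ for every sheaf $F$ on $X_{ct}$, and $\hat G$ is a reflective sheaf on $X_{ct}$ for every sheaf $G$ on $\nu(X)$. 2. The functors $F\mapsto F^\nu$ and $G\mapsto\hat G$ form an equivalence between the category of reflective sheaves on $X_{ct}$ (a full subcategory of the sheaves on $X_{ct}$) and the category of sheaves on $\nu(X)$: they are quasi-inverse to each other. 3. For every abelian group $A$, let $A_X$ be the constant sheaf on $X_{ct}$ (the sheafification of the constant presheaf) and $A_{\nu(X)}$ the constant sheaf on $\nu(X)$. Then $A_X$ is reflective, $(A_X)^\nu\cong A_{\nu(X)}$ and $\widehat{A_{\nu(X)}}\cong A_X$. -/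

import Mathlib

open CategoryTheory CategoryTheory.Limits TopologicalSpace Opposite

universe u

namespace HigsonCorona

section Metric

variable {X : Type u} [MetricSpace X]

/-- `E ⊆ X × X` is an entourage if the distance is bounded on `E`. -/
def IsEntourage (E : Set (X × X)) : Prop :=
  ∃ R : ℝ, ∀ p ∈ E, dist p.1 p.2 ≤ R

/-- Subsets `A, B` are close (`A ⋏ B`) if there are `R` and an unbounded sequence in `A × B` whose
terms `(a, b)` all satisfy `d(a, b) ≤ R`. If they are not close they are called
coarsely disjoint. -/
def Close (A B : Set X) : Prop :=
  ∃ (R : ℝ) (s : ℕ → X × X), (∀ i, (s i).1 ∈ A ∧ (s i).2 ∈ B ∧ dist (s i).1 (s i).2 ≤ R) ∧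
    ¬ Bornology.IsBounded (Set.range s)

/-- A finite family `𝒱` of subsets of `U` is a coarse cover of `U` if for every entourage
`E ⊆ U × U` the intersection (inside `U`) of the sets `E[U \ V]`, `V ∈ 𝒱`, is bounded.
The empty family is allowed; it covers `U` if and only if `U` is bounded. -/
def IsCoarseCover (U : Set X) (𝒱 : Set (Set X)) : Prop :=
  𝒱.Finite ∧ (∀ V ∈ 𝒱, V ⊆ U) ∧
    ∀ E : Set (X × X), E ⊆ U ×ˢ U → IsEntourage E →
      Bornology.IsBounded {x ∈ U | ∀ V ∈ 𝒱, ∃ y ∈ U \ V, (x, y) ∈ E}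

theorem isCoarseCover_iff (U : Set X) (𝒱 : Set (Set X)) :
    IsCoarseCover U 𝒱 ↔ 𝒱.Finite ∧ (∀ V ∈ 𝒱, V ⊆ U) ∧
      ∀ R : ℝ, 0 ≤ R → Bornology.IsBounded {x ∈ U | ∀ V ∈ 𝒱, ∃ y ∈ U \ V, dist x y ≤ R} := by
  constructor
  · rintro ⟨h1, h2, h3⟩
    refine ⟨h1, h2, fun R _ => ?_⟩
    refine (h3 {p | p.1 ∈ U ∧ p.2 ∈ U ∧ dist p.1 p.2 ≤ R} ?_ ?_).subset ?_
    · exact fun p hp => ⟨hp.1, hp.2.1⟩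
    · exact ⟨R, fun p hp => hp.2.2⟩
    · rintro x ⟨hx, h⟩
      refine ⟨hx, fun V hV => ?_⟩
      obtain ⟨y, hy, hd⟩ := h V hV
      exact ⟨y, hy, hx, hy.1, hd⟩
  · rintro ⟨h1, h2, h3⟩
    refine ⟨h1, h2, ?_⟩
    rintro E _ ⟨R, hR⟩
    refine (h3 (max R 0) (le_max_right _ _)).subset ?_
    rintro x ⟨hx, h⟩
    refine ⟨hx, fun V hV => ?_⟩
    obtain ⟨y, hy, hE⟩ := h V hV
    exact ⟨y, hy, (hR _ hE).trans (le_max_left _ _)⟩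

variable (X) in
/-- The Grothendieck topology of the site `X_ct` on the poset of subsets of `X`: a sieve is covering
if it contains the members of a coarse cover. -/
def coarseTopology : GrothendieckTopology (Set X) where
  sieves U := {S | ∃ 𝒱 : Set (Set X), IsCoarseCover U 𝒱 ∧ ∀ V ∈ 𝒱, ∃ f : V ⟶ U, S f}
  top_mem' U := by
    refine ⟨{U}, (isCoarseCover_iff _ _).2 ⟨Set.finite_singleton U, by simp, fun R _ => ?_⟩, ?_⟩
    · simp
    · intro V hV
      obtain rfl : V = U := hV
      exact ⟨𝟙 _, trivial⟩
  pullback_stable' := by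
    rintro U V S f ⟨𝒱, h𝒱, hS⟩
    obtain ⟨h1, h2, h3⟩ := (isCoarseCover_iff _ _).1 h𝒱
    refine ⟨(fun W => W ∩ V) '' 𝒱, (isCoarseCover_iff _ _).2 ⟨h1.image _, ?_, fun R hR => ?_⟩, ?_⟩
    · rintro _ ⟨W, _, rfl⟩
      exact Set.inter_subset_right
    · refine (h3 R hR).subset ?_
      rintro x ⟨hx, h⟩
      refine ⟨leOfHom f hx, fun W hW => ?_⟩
      obtain ⟨y, ⟨hy, hyW⟩, hd⟩ := h _ ⟨W, hW, rfl⟩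
      exact ⟨y, ⟨leOfHom f hy, fun hW' => hyW ⟨hW', hy⟩⟩, hd⟩
    · rintro _ ⟨W, hW, rfl⟩
      obtain ⟨g, hg⟩ := hS W hW
      have hi : W ∩ V ≤ V := Set.inter_subset_right
      have hj : W ∩ V ≤ W := Set.inter_subset_left
      refine ⟨homOfLE hi, ?_⟩
      have : S (homOfLE hj ≫ g) := S.downward_closed hg _
      rwa [Subsingleton.elim (homOfLE hj ≫ g) (homOfLE hi ≫ f)] at this
  transitive' := by
    rintro U S ⟨𝒱, h𝒱, hS⟩ T hT
    obtain ⟨h1, h2, h3⟩ := (isCoarseCover_iff _ _).1 h𝒱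
    have key : ∀ V : 𝒱, ∃ 𝒲 : Set (Set X), IsCoarseCover V.1 𝒲 ∧
        ∀ W ∈ 𝒲, ∃ f : W ⟶ U, T f := by
      rintro ⟨V, hV⟩
      obtain ⟨f, hf⟩ := hS V hV
      obtain ⟨𝒲, h, h'⟩ := hT hf
      refine ⟨𝒲, h, fun W hW => ?_⟩
      obtain ⟨g, hg⟩ := h' W hW
      exact ⟨g ≫ f, hg⟩
    choose 𝒲 h𝒲 hT' using key
    have : Finite 𝒱 := h1
    refine ⟨⋃ V, 𝒲 V, (isCoarseCover_iff _ _).2 ⟨Set.finite_iUnion fun V => (h𝒲 V).1, ?_,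
      fun R hR => ?_⟩, ?_⟩
    · intro W hW
      obtain ⟨V, hV⟩ := Set.mem_iUnion.1 hW
      exact ((h𝒲 V).2.1 W hV).trans (h2 V V.2)
    · have hb : Bornology.IsBounded (⋃ V : 𝒱,
          {x ∈ V.1 | ∀ W ∈ 𝒲 V, ∃ y ∈ V.1 \ W, dist x y ≤ R}) :=
        Bornology.isBounded_iUnion.2 fun V => ((isCoarseCover_iff _ _).1 (h𝒲 V)).2.2 R hR
      refine ((h3 R hR).union hb).subset ?_
      rintro x ⟨hx, h⟩
      by_cases hc : ∀ V ∈ 𝒱, ∃ y ∈ U \ V, dist x y ≤ R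
      · exact Or.inl ⟨hx, hc⟩
      · right
        push Not at hc
        obtain ⟨V, hV, hc⟩ := hc
        have hin : ∀ y ∈ U, dist x y ≤ R → y ∈ V := fun y hy hd => by
          by_contra hyV
          exact absurd (hc y ⟨hy, hyV⟩) (not_lt.2 hd)
        refine Set.mem_iUnion.2 ⟨⟨V, hV⟩, hin x hx (by simpa using hR), fun W hW => ?_⟩
        obtain ⟨y, ⟨hy, hyW⟩, hd⟩ := h W (Set.mem_iUnion.2 ⟨⟨V, hV⟩, hW⟩)
        exact ⟨y, ⟨hin y hy hd, hyW⟩, hd⟩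
    · intro W hW
      obtain ⟨V, hV⟩ := Set.mem_iUnion.1 hW
      exact hT' V W hV

/-! ### Elementary facts on closeness -/

theorem close_iff (A B : Set X) :
    Close A B ↔ ∃ R : ℝ, ¬ Bornology.IsBounded {a ∈ A | ∃ b ∈ B, dist a b ≤ R} := by
  constructor
  · rintro ⟨R, s, hs, hu⟩
    refine ⟨R, fun hb => hu ?_⟩
    have hb' := hb.cthickening (δ := R)
    refine (hb.prod hb').subset ?_
    rintro _ ⟨i, rfl⟩
    obtain ⟨h1, h2, h3⟩ := hs i
    have h4 : (s i).1 ∈ {a ∈ A | ∃ b ∈ B, dist a b ≤ R} := ⟨h1, _, h2, h3⟩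
    exact ⟨h4, Metric.mem_cthickening_of_dist_le _ _ _ _ h4 (by rwa [dist_comm])⟩
  · rintro ⟨R, h⟩
    have hne : {a ∈ A | ∃ b ∈ B, dist a b ≤ R}.Nonempty := by
      by_contra hc
      rw [Set.not_nonempty_iff_eq_empty] at hc
      exact h (hc ▸ Bornology.isBounded_empty)
    obtain ⟨x₀, -⟩ := hne
    have : ∀ n : ℕ, ∃ p : X × X, p.1 ∈ A ∧ p.2 ∈ B ∧ dist p.1 p.2 ≤ R ∧ n < dist p.1 x₀ := by
      intro n
      by_contra hc
      push Not at hc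
      refine h ((Metric.isBounded_closedBall (x := x₀) (r := (n : ℝ))).subset ?_)
      rintro a ⟨ha, b, hb, hd⟩
      exact hc (a, b) ha hb hd
    choose s hs using this
    refine ⟨R, s, fun i => ⟨(hs i).1, (hs i).2.1, (hs i).2.2.1⟩, fun hb => ?_⟩
    obtain ⟨r, hr⟩ := (Metric.isBounded_iff_subset_closedBall x₀).1
      (Bornology.isBounded_image_fst_and_snd.2 hb).1
    obtain ⟨n, hn⟩ := exists_nat_gt r
    have h1 := hr ⟨_, ⟨n, rfl⟩, rfl⟩
    have h2 := (hs n).2.2.2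
    rw [Metric.mem_closedBall] at h1
    linarith

theorem Close.symm {A B : Set X} (h : Close A B) : Close B A := by
  obtain ⟨R, s, hs, hu⟩ := h
  refine ⟨R, fun i => (s i).swap, fun i => ⟨(hs i).2.1, (hs i).1, ?_⟩, fun hb => hu ?_⟩
  · rw [dist_comm]
    exact (hs i).2.2
  · have hb' := Bornology.isBounded_image_fst_and_snd.2 hb
    refine (hb'.2.prod hb'.1).subset ?_
    rintro _ ⟨i, rfl⟩
    exact ⟨⟨_, ⟨i, rfl⟩, rfl⟩, ⟨_, ⟨i, rfl⟩, rfl⟩⟩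

theorem Close.mono {A A' B B' : Set X} (h : Close A B) (hA : A ⊆ A') (hB : B ⊆ B') :
    Close A' B' := by
  obtain ⟨R, s, hs, hu⟩ := h
  exact ⟨R, s, fun i => ⟨hA (hs i).1, hB (hs i).2.1, (hs i).2.2⟩, hu⟩

theorem not_close_union {A B B' : Set X} (h : ¬ Close A B) (h' : ¬ Close A B') :
    ¬ Close A (B ∪ B') := by
  rw [close_iff] at h h' ⊢
  push Not at h h' ⊢
  intro R
  refine ((h R).union (h' R)).subset ?_
  rintro a ⟨ha, b, hb | hb, hd⟩
  · exact Or.inl ⟨ha, b, hb, hd⟩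
  · exact Or.inr ⟨ha, b, hb, hd⟩

theorem isBounded_inter {A B : Set X} (h : ¬ Close A B) : Bornology.IsBounded (A ∩ B) := by
  rw [close_iff] at h
  push Not at h
  exact (h 0).subset fun a ha => ⟨ha.1, a, ha.2, by simp⟩

/-- Coarsely disjoint sets can be separated. -/
theorem exists_between {A B : Set X} (h : ¬ Close A B) :
    ∃ C : Set X, ¬ Close A C ∧ ¬ Close Cᶜ B := by
  have h' : ¬ Close B A := fun hc => h hc.symm
  have key : ∀ (A B C : Set X), ¬ Close A B →
      (∀ x ∈ C, Metric.infEDist x B ≤ Metric.infEDist x A) → ¬ Close A C := by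
    intro A B C h hC
    rw [close_iff] at h ⊢
    push Not at h ⊢
    intro R
    refine (h (R + (|R| + 1))).subset ?_
    rintro a ⟨ha, c, hc, hd⟩
    have h1 : Metric.infEDist c B < ENNReal.ofReal (|R| + 1) := by
      refine ((hC c hc).trans (Metric.infEDist_le_edist_of_mem ha)).trans_lt ?_
      rw [edist_dist, dist_comm]
      exact (ENNReal.ofReal_lt_ofReal_iff (by positivity)).2 (by linarith [le_abs_self R])
    obtain ⟨b, hb, hcb⟩ := Metric.infEDist_lt_iff.1 h1
    rw [edist_dist] at hcb
    have hcb' := (ENNReal.ofReal_lt_ofReal_iff (by positivity)).1 hcb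
    exact ⟨ha, b, hb, (dist_triangle a c b).trans (by linarith)⟩
  refine ⟨{x | Metric.infEDist x B ≤ Metric.infEDist x A}, key _ _ _ h fun x hx => hx, ?_⟩
  intro hc
  refine key _ _ _ h' (fun x hx => ?_) hc.symm
  exact le_of_lt (not_le.1 hx)

/-! ### The Higson corona -/

/-- The space of nonprincipal ultrafilters on `S`. -/
def NonprincipalUltrafilter (S : Set X) : Type u :=
  {F : Ultrafilter S // ∀ s : S, F ≠ pure s}

/-- The set of nonprincipal ultrafilters on `S` that contain `A ⊆ S`. -/
def remainder {S : Set X} (A : Set S) : Set (NonprincipalUltrafilter S) :=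
  {F | A ∈ F.1}

/-- The closeness relation on sets of nonprincipal ultrafilters. -/
def CloseSets {S : Set X} (p q : Set (NonprincipalUltrafilter S)) : Prop :=
  ∀ A B : Set S, p ⊆ remainder A → q ⊆ remainder B →
    Close (Subtype.val '' A : Set X) (Subtype.val '' B)

/-- The Kuratowski closure operator. -/
def kuratowskiClosure {S : Set X} (p : Set (NonprincipalUltrafilter S)) :
    Set (NonprincipalUltrafilter S) :=
  {F | CloseSets {F} p}

theorem kuratowskiClosure_mono {S : Set X} {p q : Set (NonprincipalUltrafilter S)} (h : p ⊆ q) :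
    kuratowskiClosure p ⊆ kuratowskiClosure q :=
  fun _ hF A B hA hB => hF A B hA (h.trans hB)

theorem kuratowskiClosure_union_subset {S : Set X} (p q : Set (NonprincipalUltrafilter S)) :
    kuratowskiClosure (p ∪ q) ⊆ kuratowskiClosure p ∪ kuratowskiClosure q := by
  intro F hF
  by_contra hc
  simp only [Set.mem_union, not_or, kuratowskiClosure, Set.mem_ofPred_eq, CloseSets] at hc
  push Not at hc
  obtain ⟨⟨A, B, hA, hB, h⟩, ⟨A', B', hA', hB', h'⟩⟩ := hc
  have h1 : {F} ⊆ remainder (A ∩ A') := by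
    rintro _ rfl
    exact Filter.inter_mem (hA rfl) (hA' rfl)
  have h2 : p ∪ q ⊆ remainder (B ∪ B') := by
    rintro G (hG | hG)
    · exact Filter.mem_of_superset (hB hG) Set.subset_union_left
    · exact Filter.mem_of_superset (hB' hG) Set.subset_union_right
  have h3 := hF _ _ h1 h2
  rw [Set.image_union] at h3
  refine not_close_union (fun hc => h ?_) (fun hc => h' ?_) h3
  · exact hc.mono (Set.image_mono Set.inter_subset_left) subset_rfl
  · exact hc.mono (Set.image_mono Set.inter_subset_right) subset_rfl

/-- The topology on the space of nonprincipal ultrafilters whose closed sets are the fixed points of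
the Kuratowski closure operator. -/
instance (S : Set X) : TopologicalSpace (NonprincipalUltrafilter S) :=
  TopologicalSpace.ofClosed {p | kuratowskiClosure p ⊆ p}
    (by
      intro F hF
      exfalso
      have h0 : ¬ Close (∅ : Set X) (Subtype.val '' (∅ᶜ : Set S)) := by
        rintro ⟨_, s, hs, -⟩
        exact (hs 0).1
      have h1 := hF ∅ᶜ ∅ (by
          rintro G rfl
          rw [Set.compl_empty]
          exact Filter.univ_mem (f := (G.1 : Filter S)))
        (Set.empty_subset _)
      rw [Set.image_empty] at h1
      exact h0 h1.symm)
    (by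
      intro P hP F hF p hp
      exact hP hp (kuratowskiClosure_mono (Set.sInter_subset_of_mem hp) hF))
    (by
      intro p hp q hq F hF
      exact (kuratowskiClosure_union_subset p q hF).imp (fun h => hp h) (fun h => hq h))

/-- The relation `λ` on nonprincipal ultrafilters: all members are pairwise close. -/
def CoronaRel {S : Set X} (F G : NonprincipalUltrafilter S) : Prop :=
  ∀ A ∈ F.1, ∀ B ∈ G.1, Close (Subtype.val '' A : Set X) (Subtype.val '' B)

/-- The Higson corona `ν(X)` (constructed from a Delone set `S` of `X`), with the quotient
topology. -/
def Corona (S : Set X) : Type u :=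
  Quot (CoronaRel (S := S))

instance (S : Set X) : TopologicalSpace (Corona S) :=
  inferInstanceAs (TopologicalSpace (Quot (CoronaRel (S := S))))

/-- If all members of `F` are close to `A` and `F λ G`, then all members of `G` are
close to `A`. -/
theorem CoronaRel.forall_close {S : Set X} {F G : NonprincipalUltrafilter S} (h : CoronaRel F G)
    {A : Set X} (hF : ∀ B ∈ F.1, Close (Subtype.val '' B) A) :
    ∀ B ∈ G.1, Close (Subtype.val '' B) A := by
  intro B hB
  by_contra hc
  obtain ⟨C, h1, h2⟩ := exists_between hc
  rcases F.1.mem_or_compl_mem (Subtype.val ⁻¹' C) with hC | hC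
  · exact h1 ((h _ hC _ hB).symm.mono subset_rfl (Set.image_preimage_subset _ _))
  · exact h2 ((hF _ hC).mono (Set.image_subset_iff.2 fun _ h => h) subset_rfl)

theorem CoronaRel.symm {S : Set X} {F G : NonprincipalUltrafilter S} (h : CoronaRel F G) :
    CoronaRel G F :=
  fun A hA B hB => (h B hB A hA).symm

theorem CoronaRel.trans {S : Set X} {F G H : NonprincipalUltrafilter S} (h : CoronaRel F G)
    (h' : CoronaRel G H) : CoronaRel F H := by
  intro A hA B hB
  exact (h'.forall_close (A := Subtype.val '' A) (fun C hC => (h A hA C hC).symm) B hB).symm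

/-- On a Delone set of a proper metric space `λ` is an equivalence relation. -/
theorem coronaRel_equivalence [ProperSpace X] (D : Delone.DeloneSet X) :
    Equivalence (CoronaRel (S := D.carrier)) := by
  refine ⟨fun F A hA B hB => ?_, CoronaRel.symm, CoronaRel.trans⟩
  by_contra hc
  have hfin : (A ∩ B).Finite := by
    have hb := (isBounded_inter hc).subset (Set.image_inter_subset Subtype.val A B)
    have htb : TotallyBounded (Subtype.val '' (A ∩ B) : Set X) :=
      hb.isCompact_closure.totallyBounded.subset subset_closure
    have hr : (0 : ℝ) < (D.packingRadius / 2 : NNReal) := by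
      have := D.packingRadius_pos
      positivity
    obtain ⟨t, ht, hsub⟩ := Metric.totallyBounded_iff.1 htb _ hr
    refine Set.Finite.of_finite_image ?_ (Subtype.val_injective.injOn)
    rw [← Set.inter_eq_left.2 hsub, Set.inter_iUnion₂]
    refine ht.biUnion fun z _ => Set.Subsingleton.finite ?_
    rintro _ ⟨⟨x, -, rfl⟩, hx⟩ _ ⟨⟨y, -, rfl⟩, hy⟩
    exact D.eq_of_mem_ball le_rfl x.2 y.2 hx hy
  obtain ⟨x, -, hx⟩ := Ultrafilter.eq_pure_of_finite_mem hfin (Filter.inter_mem hA hB)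
  exact F.2 x hx

/-- The basic closed subset of `ν(X)` assigned to a subset `A` of `X`, i.e. the intersection of
`ν(X)` with the closure of `A` in the Higson compactification: a class `[F]` belongs to it if and
only if every member of `F` is close to `A`. -/
def basicClosed (S : Set X) (A : Set X) : Set (Corona S) :=
  {q | Quot.lift (fun F : NonprincipalUltrafilter S => ∀ B ∈ F.1, Close (Subtype.val '' B) A)
    (fun _ _ h => propext ⟨h.forall_close, h.symm.forall_close⟩) q}

theorem mk_mem_basicClosed {S : Set X} {F : NonprincipalUltrafilter S} {A : Set X} :
    (Quot.mk _ F : Corona S) ∈ basicClosed S A ↔ ∀ B ∈ F.1, Close (Subtype.val '' B) A :=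
  Iff.rfl

theorem isClosed_basicClosed (S A : Set X) : IsClosed (basicClosed S A) := by
  have hq : Topology.IsQuotientMap
      (Quot.mk (CoronaRel (S := S)) : NonprincipalUltrafilter S → Corona S) :=
    isQuotientMap_quot_mk
  refine hq.isClosed_preimage.1 (isOpen_compl_iff.1 ?_)
  change (Quot.mk _ ⁻¹' basicClosed S A)ᶜᶜ ∈
    {p : Set (NonprincipalUltrafilter S) | kuratowskiClosure p ⊆ p}
  rw [compl_compl]
  intro F hF B hB
  by_contra hc
  obtain ⟨C, h1, h2⟩ := exists_between hc
  refine h1 ((hF B (Subtype.val ⁻¹' C) ?_ ?_).mono subset_rfl (Set.image_preimage_subset _ _))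
  · rintro _ rfl
    exact hB
  · intro G hG
    rcases G.1.mem_or_compl_mem (Subtype.val ⁻¹' C) with hC | hC
    · exact hC
    · exact absurd ((hG _ hC).mono ((Set.image_subset_iff (t := Cᶜ)).2 fun _ h => h) subset_rfl) h2

theorem basicClosed_mono (S : Set X) {A B : Set X} (h : A ⊆ B) :
    basicClosed S A ⊆ basicClosed S B := by
  rintro ⟨F⟩ hF C hC
  exact (hF C hC).mono subset_rfl h

/-- The basic open subset of `ν(X)` assigned to `U`: the complement of the basic closed set of the
complement of `U`. -/
def basicOpen (S U : Set X) : Opens (Corona S) :=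
  ⟨(basicClosed S Uᶜ)ᶜ, (isClosed_basicClosed S Uᶜ).isOpen_compl⟩

theorem basicOpen_mono (S : Set X) {U V : Set X} (h : U ⊆ V) : basicOpen S U ≤ basicOpen S V :=
  Set.compl_subset_compl.2 (basicClosed_mono S (Set.compl_subset_compl.2 h))

/-- `A` and `B` are coarsely disjoint if and only if their basic closed sets are disjoint. -/
theorem disjoint_basicClosed_iff (D : Delone.DeloneSet X) {A B : Set X} :
    Disjoint (basicClosed D.carrier A) (basicClosed D.carrier B) ↔ ¬ Close A B := by
  constructor
  · intro hdis hcl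
    obtain ⟨R, hR⟩ := (close_iff _ _).1 hcl
    let r : ℝ := (D.coveringRadius : ℝ)
    let C : Set D.carrier := {s | (∃ a ∈ A, dist s.1 a ≤ r) ∧ ∃ b ∈ B, dist s.1 b ≤ r + R}
    have hC : ¬ Bornology.IsBounded (Subtype.val '' C : Set X) := by
      intro hb
      refine hR ((hb.cthickening (δ := r)).subset ?_)
      rintro a ⟨ha, b, hb, hd⟩
      obtain ⟨s, hs, has⟩ := D.exists_dist_le_coveringRadius a
      refine Metric.mem_cthickening_of_dist_le a s r _ ⟨⟨s, hs⟩, ⟨⟨a, ha, ?_⟩, b, hb, ?_⟩, rfl⟩ has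
      · rwa [dist_comm]
      · exact (dist_triangle s a b).trans (add_le_add (by rwa [dist_comm]) hd)
    let f : Filter D.carrier :=
      Filter.comap Subtype.val (Bornology.cobounded X) ⊓ Filter.principal C
    have hf : f.NeBot := by
      rw [Filter.inf_principal_neBot_iff]
      rintro T ⟨W, hW, hWT⟩
      by_contra hc
      rw [Set.not_nonempty_iff_eq_empty] at hc
      refine hC ((Bornology.isBounded_compl_iff.2 hW).subset ?_)
      rintro _ ⟨s, hs, rfl⟩ hsW
      have : s ∈ T ∩ C := ⟨hWT hsW, hs⟩
      rw [hc] at this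
      exact this
    have hunb : ∀ T ∈ Ultrafilter.of f, ¬ Bornology.IsBounded (Subtype.val '' (T ∩ C) : Set X) := by
      intro T hT hb
      have h1 : C ∈ Ultrafilter.of f :=
        Ultrafilter.of_le f (Filter.mem_inf_of_right (Filter.mem_principal_self C))
      have h2 : (Subtype.val ⁻¹' (Subtype.val '' (T ∩ C))ᶜ : Set D.carrier) ∈ Ultrafilter.of f :=
        Ultrafilter.of_le f (Filter.mem_inf_of_left ⟨_, hb, subset_rfl⟩)
      obtain ⟨s, hs⟩ := Ultrafilter.nonempty_of_mem (Filter.inter_mem (Filter.inter_mem hT h1) h2)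
      exact hs.2 ⟨s, hs.1, rfl⟩
    let F : NonprincipalUltrafilter D.carrier := ⟨Ultrafilter.of f, fun s hs => by
      have h1 : ({s} : Set D.carrier) ∈ Ultrafilter.of f := by
        rw [hs]
        exact Ultrafilter.mem_pure.2 rfl
      refine hunb _ h1 ((Set.Finite.isBounded ?_))
      exact ((Set.finite_singleton s).subset Set.inter_subset_left).image _⟩
    have hA : (Quot.mk _ F : Corona D.carrier) ∈ basicClosed D.carrier A := by
      refine mk_mem_basicClosed.2 fun T hT => (close_iff _ _).2 ⟨r, fun hb => hunb T hT ?_⟩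
      refine hb.subset ?_
      rintro _ ⟨s, hs, rfl⟩
      exact ⟨⟨s, hs.1, rfl⟩, hs.2.1⟩
    have hB : (Quot.mk _ F : Corona D.carrier) ∈ basicClosed D.carrier B := by
      refine mk_mem_basicClosed.2 fun T hT => (close_iff _ _).2 ⟨r + R, fun hb => hunb T hT ?_⟩
      refine hb.subset ?_
      rintro _ ⟨s, hs, rfl⟩
      exact ⟨⟨s, hs.1, rfl⟩, hs.2.2⟩
    exact Set.disjoint_left.1 hdis hA hB
  · intro h
    rw [Set.disjoint_left]
    rintro ⟨F⟩ hA hB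
    obtain ⟨C, h1, h2⟩ := exists_between h
    rcases F.1.mem_or_compl_mem (Subtype.val ⁻¹' C) with hC | hC
    · exact h1 ((hA _ hC).symm.mono subset_rfl (Set.image_preimage_subset _ _))
    · exact h2 ((hB _ hC).mono (Set.image_subset_iff.2 fun _ h => h) subset_rfl)

end Metric

section Sheaves

variable {X : Type u} [MetricSpace X]

/-! ### The functor `F ↦ F^ν` -/

/-- The index set of the sections of `F^ν` over an open set `p`: all `A` that are coarsely disjoint
from the complement of some `U` whose basic open set is contained in `p`. -/
def Inner (S : Set X) (p : Opens (Corona S)) (A : Set X) : Prop :=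
  ∃ U : Set X, basicOpen S U ≤ p ∧ ¬ Close A Uᶜ

/-- Over a basic open set the index set is the expected one. -/
theorem inner_basicOpen_iff (D : Delone.DeloneSet X) (U A : Set X) :
    Inner D.carrier (basicOpen D.carrier U) A ↔ ¬ Close A Uᶜ := by
  refine ⟨?_, fun h => ⟨U, le_rfl, h⟩⟩
  rintro ⟨V, hV, h⟩
  rw [← disjoint_basicClosed_iff D] at h ⊢
  exact h.mono_right (Set.compl_subset_compl.1 hV)

/-- Sections of `F^ν` over an open subset `p` of `ν(X)`: the limit of the groups `F(A)` over the
index set, i.e. the group of compatible families. Over the basic open set of `U` this is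
`lim F(A)` over the sets `A` coarsely disjoint from the complement of `U`; over arbitrary
open sets it is the limit of these groups over the basic open subsets of `p`. -/
def nuSections (S : Set X) (F : (Set X)ᵒᵖ ⥤ AddCommGrpCat.{u}) (p : Opens (Corona S)) :
    AddSubgroup (∀ A : {A : Set X // Inner S p A}, F.obj (op A.1)) where
  carrier := {s | ∀ (A B : {A : Set X // Inner S p A}) (f : A.1 ⟶ B.1), F.map f.op (s B) = s A}
  add_mem' := by
    intro s t hs ht A B f
    rw [Pi.add_apply, Pi.add_apply, map_add, hs, ht]
  zero_mem' := by
    intro A B f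
    simp
  neg_mem' := by
    intro s hs A B f
    rw [Pi.neg_apply, Pi.neg_apply, map_neg, hs]

/-- The presheaf `F^ν`. The restriction maps restrict families to smaller index sets. -/
def nuPresheafObj (S : Set X) (F : (Set X)ᵒᵖ ⥤ AddCommGrpCat.{u}) :
    TopCat.Presheaf AddCommGrpCat.{u} (TopCat.of (Corona S)) where
  obj p := AddCommGrpCat.of (nuSections S F p.unop)
  map i := AddCommGrpCat.ofHom
    { toFun := fun s => ⟨fun A => s.1 ⟨A.1, A.2.imp fun _ h => ⟨h.1.trans (leOfHom i.unop), h.2⟩⟩,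
        fun A B f => s.2 ⟨A.1, _⟩ ⟨B.1, _⟩ f⟩
      map_zero' := rfl
      map_add' := fun _ _ => rfl }
  map_id _ := rfl
  map_comp _ _ := rfl

/-- The functor `F ↦ F^ν` on presheaves; a morphism is applied componentwise to families. -/
def nuPresheaf (S : Set X) :
    ((Set X)ᵒᵖ ⥤ AddCommGrpCat.{u}) ⥤
      TopCat.Presheaf AddCommGrpCat.{u} (TopCat.of (Corona S)) where
  obj F := nuPresheafObj S F
  map {F F'} α :=
    { app := fun p => AddCommGrpCat.ofHom
        { toFun := fun (s : nuSections S F p.unop) => (⟨fun A => α.app (op A.1) (s.1 A), fun A B f => by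
            refine Eq.trans ?_ (congrArg (α.app (op A.1)) (s.2 A B f))
            exact (ConcreteCategory.congr_hom (α.naturality f.op) (s.1 B)).symm⟩ : nuSections S F' p.unop)
          map_zero' := Subtype.ext (funext fun _ => map_zero _)
          map_add' := fun _ _ => Subtype.ext (funext fun _ => map_add _ _ _) }
      naturality := fun _ _ _ => rfl }
  map_id _ := rfl
  map_comp _ _ := rfl

/-! ### The functor `G ↦ Ĝ` -/

/-- The poset of subsets `U` of `X` whose complement is coarsely disjoint from `A`. -/
abbrev CoarseNhd (A : Set X) : Type u :=
  {U : Set X // ¬ Close A Uᶜ}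

/-- `U ↦` the basic open set of `U`. -/
def coarseNhdToOpens (S A : Set X) :
    (CoarseNhd A)ᵒᵖ ⥤ (Opens (TopCat.of (Corona S)))ᵒᵖ :=
  (Monotone.functor (f := fun U : CoarseNhd A => (basicOpen S U.1 : Opens (TopCat.of (Corona S))))
    (fun _ _ h => basicOpen_mono S h)).op

theorem not_close_of_hom {A B : Set X} (f : A ⟶ B) (U : CoarseNhd B) : ¬ Close A U.1ᶜ :=
  fun h => U.2 (h.mono (leOfHom f) subset_rfl)

/-- The group `Ĝ(A)`: the colimit of the sections of `G` over the basic open sets of the subsets `U`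
whose complement is coarsely disjoint from `A`. -/
noncomputable def hatObj (S : Set X)
    (G : TopCat.Presheaf AddCommGrpCat.{u} (TopCat.of (Corona S))) (A : Set X) :
    AddCommGrpCat.{u} :=
  colimit (coarseNhdToOpens S A ⋙ G)

/-- The class in `Ĝ(A)` of a section over the basic open set of `U`. -/
noncomputable def hatMk (S : Set X)
    (G : TopCat.Presheaf AddCommGrpCat.{u} (TopCat.of (Corona S))) (A : Set X) (U : CoarseNhd A) :
    G.obj (op (basicOpen S U.1)) ⟶ hatObj S G A :=
  colimit.ι (coarseNhdToOpens S A ⋙ G) (op U)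

theorem hat_hom_ext {S : Set X} {G : TopCat.Presheaf AddCommGrpCat.{u} (TopCat.of (Corona S))}
    {A : Set X} {H : AddCommGrpCat.{u}} {f g : hatObj S G A ⟶ H}
    (h : ∀ U, hatMk S G A U ≫ f = hatMk S G A U ≫ g) : f = g :=
  colimit.hom_ext fun U => h U.unop

/-- The restriction map `Ĝ(B) → Ĝ(A)`, which maps the class of a section over the basic open set of
`U` to the class of the same section. -/
noncomputable def hatRestrict (S : Set X)
    (G : TopCat.Presheaf AddCommGrpCat.{u} (TopCat.of (Corona S))) {A B : Set X} (f : A ⟶ B) :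
    hatObj S G B ⟶ hatObj S G A :=
  colimit.desc (coarseNhdToOpens S B ⋙ G)
    { pt := hatObj S G A
      ι :=
        { app := fun U => hatMk S G A ⟨U.unop.1, not_close_of_hom f U.unop⟩
          naturality := fun U V j => by
            have := colimit.w (coarseNhdToOpens S A ⋙ G)
              (Quiver.Hom.op (homOfLE (leOfHom j.unop) :
                (⟨V.unop.1, not_close_of_hom f V.unop⟩ : CoarseNhd A) ⟶
                  ⟨U.unop.1, not_close_of_hom f U.unop⟩))
            exact this.trans (Category.comp_id _).symm } }

theorem hatMk_hatRestrict (S : Set X)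
    (G : TopCat.Presheaf AddCommGrpCat.{u} (TopCat.of (Corona S))) {A B : Set X} (f : A ⟶ B)
    (U : CoarseNhd B) :
    hatMk S G B U ≫ hatRestrict S G f = hatMk S G A ⟨U.1, not_close_of_hom f U⟩ :=
  colimit.ι_desc _ _

/-- The presheaf `Ĝ`. -/
noncomputable def hatPresheafObj (S : Set X)
    (G : TopCat.Presheaf AddCommGrpCat.{u} (TopCat.of (Corona S))) :
    (Set X)ᵒᵖ ⥤ AddCommGrpCat.{u} where
  obj A := hatObj S G A.unop
  map i := hatRestrict S G i.unop
  map_id A := hat_hom_ext fun U =>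
    (hatMk_hatRestrict S G (𝟙 A.unop) U).trans (Category.comp_id _).symm
  map_comp {C B A} i j := hat_hom_ext fun U => by
    refine (hatMk_hatRestrict S G (i ≫ j).unop U).trans ?_
    rw [← Category.assoc, hatMk_hatRestrict, hatMk_hatRestrict]

/-- The map `Ĝ(A) → Ĝ'(A)` induced by `G → G'`. -/
noncomputable def hatMap (S : Set X)
    {G G' : TopCat.Presheaf AddCommGrpCat.{u} (TopCat.of (Corona S))} (β : G ⟶ G') (A : Set X) :
    hatObj S G A ⟶ hatObj S G' A :=
  colimMap (Functor.whiskerLeft (coarseNhdToOpens S A) β)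

theorem hatMk_hatMap (S : Set X)
    {G G' : TopCat.Presheaf AddCommGrpCat.{u} (TopCat.of (Corona S))} (β : G ⟶ G') (A : Set X)
    (U : CoarseNhd A) :
    hatMk S G A U ≫ hatMap S β A =
      β.app (op (basicOpen S U.1)) ≫ hatMk S G' A U :=
  ι_colimMap _ _

/-- The functor `G ↦ Ĝ` on presheaves. -/
noncomputable def hatPresheaf (S : Set X) :
    TopCat.Presheaf AddCommGrpCat.{u} (TopCat.of (Corona S)) ⥤
      ((Set X)ᵒᵖ ⥤ AddCommGrpCat.{u}) where
  obj G := hatPresheafObj S G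
  map {G G'} β :=
    { app := fun A => hatMap S β A.unop
      naturality := fun B A i => hat_hom_ext fun U => by
        change hatMk S G B.unop U ≫ hatRestrict S G i.unop ≫ hatMap S β A.unop =
          hatMk S G B.unop U ≫ hatMap S β B.unop ≫ hatRestrict S G' i.unop
        rw [← Category.assoc, hatMk_hatRestrict, hatMk_hatMap, ← Category.assoc, hatMk_hatMap,
          Category.assoc, hatMk_hatRestrict] }
  map_id G := by
    ext A : 2
    refine hat_hom_ext fun U => (hatMk_hatMap S (𝟙 G) A.unop U).trans ?_
    exact (Category.id_comp _).trans (Category.comp_id _).symm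
  map_comp {G G' G''} α β := by
    ext A : 2
    refine hat_hom_ext fun U => (hatMk_hatMap S (α ≫ β) A.unop U).trans ?_
    change _ = hatMk S G A.unop U ≫ hatMap S α A.unop ≫ hatMap S β A.unop
    rw [← Category.assoc, hatMk_hatMap, Category.assoc, hatMk_hatMap, ← Category.assoc]
    rfl

/-! ### Reflective sheaves -/

variable (X) in
/-- The category of sheaves of abelian groups on `X_ct`. -/
abbrev CoarseSheaf : Type (u + 1) :=
  Sheaf (coarseTopology X) AddCommGrpCat.{u}

/-- Sections of a sheaf on `X_ct` do not change if the set is changed by a bounded set. -/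
theorem isIso_map_of_isBounded (F : CoarseSheaf X) {V A : Set X} (f : V ⟶ A)
    (h : Bornology.IsBounded (A \ V)) : IsIso (F.obj.map f.op) := by
  have hcov : Sieve.ofArrows (fun _ : Unit => V) (fun _ => f) ∈ coarseTopology X A := by
    refine ⟨{V}, (isCoarseCover_iff _ _).2 ⟨Set.finite_singleton V, ?_, fun R _ => ?_⟩, ?_⟩
    · rintro _ rfl
      exact leOfHom f
    · refine (h.cthickening (δ := R)).subset ?_
      rintro x ⟨-, hx⟩
      obtain ⟨y, hy, hd⟩ := hx V rfl
      exact Metric.mem_cthickening_of_dist_le x y R _ hy hd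
    · rintro _ rfl
      exact ⟨f, Sieve.ofArrows_mk _ _ ()⟩
  obtain ⟨g, hg, -⟩ := F.property.existsUnique_amalgamation_ofArrows (fun _ : Unit => f) hcov
    (fun _ => 𝟙 (F.obj.obj (op V)))
    (fun W _ _ a b _ => by rw [Subsingleton.elim a b])
  refine ⟨g, ?_, hg ()⟩
  refine F.property.hom_ext_ofArrows (fun _ : Unit => f) hcov fun i => ?_
  rw [Category.assoc, hg i, Category.comp_id, Category.id_comp]

/-- If `A` is coarsely disjoint from the complement of `U` then `A` is contained in `U` up to a
bounded set. The restriction map `F(U) → F(A)` is the composition of `F(U) → F(A ∩ U)` with the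
inverse of the isomorphism `F(A) → F(A ∩ U)`. -/
noncomputable def coarseRestrict (F : CoarseSheaf X) (A : Set X) (U : CoarseNhd A) :
    F.obj.obj (op U.1) ⟶ F.obj.obj (op A) :=
  have : IsIso (F.obj.map (homOfLE (Set.inter_subset_left : A ∩ U.1 ⊆ A)).op) :=
    isIso_map_of_isBounded F _ (by
      rw [Set.sdiff_self_inter, Set.sdiff_eq]
      exact isBounded_inter U.2)
  F.obj.map (homOfLE (Set.inter_subset_right : A ∩ U.1 ⊆ U.1)).op ≫
    inv (F.obj.map (homOfLE (Set.inter_subset_left : A ∩ U.1 ⊆ A)).op)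

theorem coarseRestrict_comp (F : CoarseSheaf X) (A : Set X) (U : CoarseNhd A) :
    coarseRestrict F A U ≫ F.obj.map (homOfLE (Set.inter_subset_left : A ∩ U.1 ⊆ A)).op =
      F.obj.map (homOfLE (Set.inter_subset_right : A ∩ U.1 ⊆ U.1)).op := by
  simp [coarseRestrict]

/-- For `A ⊆ U` it is the usual restriction map. -/
theorem coarseRestrict_eq (F : CoarseSheaf X) (A : Set X) (U : CoarseNhd A) (f : A ⟶ U.1) :
    coarseRestrict F A U = F.obj.map f.op := by
  have : IsIso (F.obj.map (homOfLE (Set.inter_subset_left : A ∩ U.1 ⊆ A)).op) :=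
    isIso_map_of_isBounded F _ (by
      rw [Set.sdiff_self_inter, Set.sdiff_eq]
      exact isBounded_inter U.2)
  rw [← cancel_mono (F.obj.map (homOfLE (Set.inter_subset_left : A ∩ U.1 ⊆ A)).op),
    coarseRestrict_comp, ← F.obj.map_comp]
  rfl

/-- The forgetful functor from the sets `U` whose complement is coarsely disjoint from `A`. -/
def coarseNhdToSet (A : Set X) : (CoarseNhd A)ᵒᵖ ⥤ (Set X)ᵒᵖ :=
  (Subtype.mono_coe (fun U : Set X => ¬ Close A Uᶜ)).functor.op

/-- The canonical map from the colimit of the groups `F(U)` to `F(A)`. -/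
noncomputable def reflectionMap (F : CoarseSheaf X) (A : Set X) :
    colimit (coarseNhdToSet A ⋙ F.obj) ⟶ F.obj.obj (op A) :=
  colimit.desc (coarseNhdToSet A ⋙ F.obj)
    { pt := F.obj.obj (op A)
      ι :=
        { app := fun U => coarseRestrict F A U.unop
          naturality := fun U V j => by
            have : IsIso (F.obj.map
                (homOfLE (Set.inter_subset_left : A ∩ V.unop.1 ⊆ A)).op) :=
              isIso_map_of_isBounded F _ (by
                rw [Set.sdiff_self_inter, Set.sdiff_eq]
                exact isBounded_inter V.unop.2)
            rw [← cancel_mono (F.obj.map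
              (homOfLE (Set.inter_subset_left : A ∩ V.unop.1 ⊆ A)).op)]
            change (F.obj.map (homOfLE (leOfHom j.unop) : V.unop.1 ⟶ U.unop.1).op ≫
              coarseRestrict F A V.unop) ≫ _ = (coarseRestrict F A U.unop ≫ 𝟙 _) ≫ _
            have hVU : A ∩ V.unop.1 ⊆ A ∩ U.unop.1 :=
              Set.inter_subset_inter_right A (leOfHom j.unop)
            have h2 : F.obj.map (homOfLE (Set.inter_subset_left : A ∩ V.unop.1 ⊆ A)).op =
                F.obj.map (homOfLE (Set.inter_subset_left : A ∩ U.unop.1 ⊆ A)).op ≫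
                  F.obj.map (homOfLE hVU).op := by
              rw [← F.obj.map_comp]
              rfl
            rw [Category.assoc, coarseRestrict_comp, Category.comp_id, h2, ← Category.assoc,
              coarseRestrict_comp, ← F.obj.map_comp, ← F.obj.map_comp]
            rfl } }

/-- A sheaf on `X_ct` is reflective if for every `A` the canonical map
`colim F(U) → F(A)`, over the sets `U` whose complement is coarsely disjoint from `A`,
is an isomorphism. -/
def IsReflective : ObjectProperty (CoarseSheaf X) :=
  fun F => ∀ A : Set X, IsIso (reflectionMap F A)

/-- The functor `F ↦ F^ν` from sheaves on `X_ct` to sheaves on `ν(X)`, once it is known to take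
sheaves to sheaves. -/
def nuSheaf (S : Set X)
    (h : ∀ F : CoarseSheaf X, TopCat.Presheaf.IsSheaf ((nuPresheaf S).obj F.obj)) :
    CoarseSheaf X ⥤ TopCat.Sheaf AddCommGrpCat.{u} (TopCat.of (Corona S)) :=
  ObjectProperty.lift _ (sheafToPresheaf _ _ ⋙ nuPresheaf S) h

/-- The functor `G ↦ Ĝ` from sheaves on `ν(X)` to sheaves on `X_ct`, once it is known to take
sheaves to sheaves. -/
noncomputable def hatSheaf (S : Set X)
    (h : ∀ G : TopCat.Sheaf AddCommGrpCat.{u} (TopCat.of (Corona S)),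
      Presheaf.IsSheaf (coarseTopology X) ((hatPresheaf S).obj G.obj)) :
    TopCat.Sheaf AddCommGrpCat.{u} (TopCat.of (Corona S)) ⥤ CoarseSheaf X :=
  ObjectProperty.lift _ (TopCat.Sheaf.forget _ _ ⋙ hatPresheaf S) h

/-- The constant sheaf `A_X` on `X_ct`. -/
noncomputable def constantCoarseSheaf (X : Type u) [MetricSpace X] (A : AddCommGrpCat.{u}) :
    CoarseSheaf X :=
  (constantSheaf (coarseTopology X) AddCommGrpCat.{u}).obj A

/-- The constant sheaf `A_Y` on a topological space `Y`. -/
noncomputable def constantTopSheaf (Y : TopCat.{u}) (A : AddCommGrpCat.{u}) :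
    TopCat.Sheaf AddCommGrpCat.{u} Y :=
  (constantSheaf (Opens.grothendieckTopology Y) AddCommGrpCat.{u}).obj A

end Sheaves

end HigsonCorona

namespace HigsonCorona

/-! ### Basic closed sets, coarse covers and compactness of the corona -/

section Topology

variable {X : Type u} [MetricSpace X]

/-! The metric data on both sides are translated into the topology of the compact space ν(X) by
means of A ↦ A^ν. Coarse disjointness of A and Uᶜ means A^ν ⊆ O_U
(`basicClosed_subset_basicOpen_iff`), and a finite family of subsets V of A is a coarse cover iff
the sets (A \ V)^ν have no common point in A^ν (`isCoarseCover_iff_forall_mem_basicClosed`).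
Compactness and separation then show that the sets O_U with A^ν ⊆ O_U are cofinal among all open
neighbourhoods of A^ν (`exists_basicClosed_subset_basicOpen_le`).

Hence F^ν(p) is the limit of F(A) over all A with A^ν ⊆ p (`inner_iff`), and Ĝ(A) is the group of
germs of G along the closed set A^ν, where equality can be tested at the points of A^ν
(`germ_eq_iff`). The sheaf property of F^ν follows because an open cover of A^ν can be refined to a
coarse cover of A. The sheaf property of Ĝ is the classical gluing of germs along closed subsets of
a compact space (`hat_exists_glue`).

Taking all germs of a section gives a unit G → (Ĝ)^ν, and taking the component at A gives a counit
from the hat of F^ν to F, so hat is left adjoint to ν (`hatNuAdjunction`). The unit is always an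
isomorphism, because points have neighbourhoods O_C ⊆ C^ν inside any given open set. The counit is
an isomorphism if F is reflective, since then an element of F(A), or its vanishing, spreads to a
coarse neighbourhood of A. Every Ĝ is reflective because germs extend to neighbourhoods, so the
adjunction restricts to an equivalence.

For constant sheaves, F^ν(ν(X)) = F(X). Thus the hat of the constant sheaf functor and the constant
sheaf functor on X_ct are left adjoint to the same functor, hence isomorphic. -/

theorem not_close_empty (A : Set X) : ¬ Close A ∅ := by
  rintro ⟨_, s, hs, -⟩
  exact (hs 0).2.1

theorem basicClosed_union (S A B : Set X) :
    basicClosed S (A ∪ B) = basicClosed S A ∪ basicClosed S B := by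
  refine subset_antisymm ?_ (Set.union_subset (basicClosed_mono S Set.subset_union_left)
    (basicClosed_mono S Set.subset_union_right))
  rintro ⟨F⟩ hF
  by_contra hc
  obtain ⟨h1, h2⟩ := not_or.1 hc
  have h1' : ∃ T ∈ F.1, ¬ Close (Subtype.val '' T) A := by
    by_contra hc
    push Not at hc
    exact h1 hc
  have h2' : ∃ T ∈ F.1, ¬ Close (Subtype.val '' T) B := by
    by_contra hc
    push Not at hc
    exact h2 hc
  obtain ⟨T, hT, hTA⟩ := h1'
  obtain ⟨T', hT', hTB⟩ := h2'
  refine not_close_union (A := Subtype.val '' (T ∩ T')) (fun h => hTA ?_) (fun h => hTB ?_)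
    (hF _ (Filter.inter_mem hT hT'))
  · exact h.mono (Set.image_mono Set.inter_subset_left) subset_rfl
  · exact h.mono (Set.image_mono Set.inter_subset_right) subset_rfl

theorem basicClosed_empty (S : Set X) : basicClosed S ∅ = ∅ := by
  rw [Set.eq_empty_iff_forall_notMem]
  rintro ⟨F⟩ hF
  exact not_close_empty _ (hF Set.univ Filter.univ_mem)

theorem exists_mem_basicClosed_of_subset_biUnion {S : Set X} {ι : Type*} {I : Set ι}
    (hI : I.Finite) {A : Set X} {f : ι → Set X} (hA : A ⊆ ⋃ i ∈ I, f i) {q : Corona S}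
    (hq : q ∈ basicClosed S A) : ∃ i ∈ I, q ∈ basicClosed S (f i) := by
  replace hq := basicClosed_mono S hA hq
  clear hA
  induction I, hI using Set.Finite.induction_on with
  | empty =>
    rw [Set.biUnion_empty, basicClosed_empty] at hq
    exact hq.elim
  | insert _ _ ih =>
    rw [Set.biUnion_insert, basicClosed_union] at hq
    rcases hq with hq | hq
    · exact ⟨_, Set.mem_insert _ _, hq⟩
    · obtain ⟨i, hi, hqi⟩ := ih hq
      exact ⟨i, Set.mem_insert_of_mem _ hi, hqi⟩

theorem mem_basicClosed_diff_or_inter {S A : Set X} (V : Set X) {q : Corona S}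
    (hq : q ∈ basicClosed S A) :
    q ∈ basicClosed S (A \ V) ∨ q ∈ basicClosed S (A ∩ V) := by
  rw [← Set.sdiff_union_inter A V, basicClosed_union] at hq
  exact hq

theorem basicClosed_subset_of_dist_le {S B C : Set X} {R : ℝ}
    (h : ∀ x ∈ C, ∃ b ∈ B, dist x b ≤ R) : basicClosed S C ⊆ basicClosed S B := by
  rintro ⟨F⟩ hF T hT
  obtain ⟨r, hr⟩ := (close_iff _ _).1 (hF T hT)
  refine (close_iff _ _).2 ⟨r + R, fun hb => hr (hb.subset ?_)⟩
  rintro t ⟨ht, c, hc, hd⟩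
  obtain ⟨b, hbB, hcb⟩ := h c hc
  exact ⟨ht, b, hbB, (dist_triangle t c b).trans (add_le_add hd hcb)⟩

/-- A^ν is the union of (A \ C)^ν and (A ∩ C)^ν, and the former lies in (Cᶜ)^ν. This replaces the
false rule that A ↦ A^ν commutes with intersections. -/
theorem basicClosed_inter_basicOpen_subset {S A C : Set X} {q : Corona S}
    (hA : q ∈ basicClosed S A) (hC : q ∈ basicOpen S C) : q ∈ basicClosed S (A ∩ C) :=
  (mem_basicClosed_diff_or_inter C hA).resolve_left fun h =>
    hC (basicClosed_mono S (fun _ hx => hx.2) h)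

theorem close_self_of_mem {S T : Set X} {A : Set S} (F : NonprincipalUltrafilter S)
    (hr : CoronaRel F F) (hA : A ∈ F.1) (hT : Subtype.val '' A ⊆ T) :
    (Quot.mk _ F : Corona S) ∈ basicClosed S T :=
  fun B hB => (hr B hB A hA).mono subset_rfl hT

variable (D : Delone.DeloneSet X)

theorem basicClosed_subset_basicOpen_iff {A U : Set X} :
    basicClosed D.carrier A ⊆ basicOpen D.carrier U ↔ ¬ Close A Uᶜ := by
  rw [← disjoint_basicClosed_iff D, Set.disjoint_left]
  rfl

/-- A finite family of subsets of `A` is a coarse cover if and only if the basic closed sets of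
the complements have no common point in the basic closed set of `A`. -/
theorem isCoarseCover_iff_forall_mem_basicClosed {A : Set X} {𝒱 : Set (Set X)} :
    IsCoarseCover A 𝒱 ↔ 𝒱.Finite ∧ (∀ V ∈ 𝒱, V ⊆ A) ∧
      ∀ q ∈ basicClosed D.carrier A, ∃ V ∈ 𝒱, q ∉ basicClosed D.carrier (A \ V) := by
  rw [isCoarseCover_iff]
  refine and_congr_right fun hfin => and_congr_right fun _ => ⟨fun h q hq => ?_, fun h R hR => ?_⟩
  · rcases 𝒱.eq_empty_or_nonempty with rfl | hne
    · exfalso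
      have hb := h 0 le_rfl
      simp only [Set.mem_empty_iff_false, false_imp_iff, implies_true, and_true] at hb
      have : ¬ Close A A := by
        rw [close_iff]
        push Not
        exact fun R => hb.subset fun x hx => hx.1
      exact Set.disjoint_left.1 ((disjoint_basicClosed_iff D).2 this) hq hq
    -- `C V` consists of the points of A at which V maximises the distance to A \ V. Close to A \ V,
    -- such a point is close to every A \ W, and the cover condition bounds the set of these points.
    let C : Set X → Set X := fun V =>
      {x ∈ A | ∀ W ∈ 𝒱, Metric.infEDist x (A \ W) ≤ Metric.infEDist x (A \ V)}
    have hC : A ⊆ ⋃ V ∈ 𝒱, C V := by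
      intro x hx
      obtain ⟨V, hV, hmax⟩ := Set.exists_max_image 𝒱 (fun W => Metric.infEDist x (A \ W)) hfin hne
      exact Set.mem_biUnion hV ⟨hx, hmax⟩
    obtain ⟨V, hV, hqV⟩ := exists_mem_basicClosed_of_subset_biUnion hfin hC hq
    refine ⟨V, hV, fun hc => ?_⟩
    have hcl : Close (C V) (A \ V) := by
      by_contra hcl
      exact Set.disjoint_left.1 ((disjoint_basicClosed_iff D).2 hcl) hqV hc
    obtain ⟨R, hR⟩ := (close_iff _ _).1 hcl
    -- The extra 1 gives a strict bound on the infimum distance, so that it is witnessed by a point;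
    -- the absolute value is there because R may be negative.
    refine hR ((h (|R| + 1) (by positivity)).subset ?_)
    rintro x ⟨hx, b, hb, hd⟩
    refine ⟨hx.1, fun W hW => ?_⟩
    have h1 : Metric.infEDist x (A \ W) < ENNReal.ofReal (|R| + 1) := by
      refine ((hx.2 W hW).trans (Metric.infEDist_le_edist_of_mem hb)).trans_lt ?_
      rw [edist_dist]
      exact (ENNReal.ofReal_lt_ofReal_iff (by positivity)).2 (by linarith [le_abs_self R])
    obtain ⟨y, hy, hxy⟩ := Metric.infEDist_lt_iff.1 h1
    rw [edist_dist] at hxy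
    exact ⟨y, hy, ((ENNReal.ofReal_lt_ofReal_iff (by positivity)).1 hxy).le⟩
  · by_contra hb
    set C := {x ∈ A | ∀ V ∈ 𝒱, ∃ y ∈ A \ V, dist x y ≤ R} with hC
    -- An unbounded set is close to itself, so it has a point at infinity. As C lies in the
    -- R-neighbourhood of each A \ V, that point lies in every (A \ V)^ν.
    have hcl : Close C C := (close_iff _ _).2 ⟨0, fun hb' => hb (hb'.subset fun x hx =>
      ⟨hx, x, hx, (dist_self x).le⟩)⟩
    rw [← not_not (a := Close C C), ← disjoint_basicClosed_iff D, Set.not_disjoint_iff] at hcl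
    obtain ⟨q, hq, -⟩ := hcl
    obtain ⟨V, hV, hqV⟩ := h q (basicClosed_mono _ (fun x hx => hx.1) hq)
    exact hqV (basicClosed_subset_of_dist_le (fun x hx => hx.2 V hV) hq)

theorem basicClosed_inter_eq {A U : Set X} (h : ¬ Close A Uᶜ) :
    basicClosed D.carrier (A ∩ U) = basicClosed D.carrier A :=
  subset_antisymm (basicClosed_mono _ Set.inter_subset_left) fun _ hq =>
    basicClosed_inter_basicOpen_subset hq ((basicClosed_subset_basicOpen_iff D).2 h hq)

/-- A \ (A ∩ C) lies in Cᶜ, so a point of O_C is not in its basic closed set. This turns finite open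
covers of A^ν into coarse covers of A. -/
theorem isCoarseCover_image_inter {A : Set X} {𝒞 : Set (Set X)} (hfin : 𝒞.Finite)
    (h : ∀ q ∈ basicClosed D.carrier A, ∃ C ∈ 𝒞, q ∈ basicOpen D.carrier C) :
    IsCoarseCover A ((fun C => A ∩ C) '' 𝒞) := by
  refine (isCoarseCover_iff_forall_mem_basicClosed D).2 ⟨hfin.image _, ?_, fun q hq => ?_⟩
  · rintro _ ⟨C, -, rfl⟩
    exact Set.inter_subset_left
  · obtain ⟨C, hC, hqC⟩ := h q hq
    refine ⟨_, ⟨C, hC, rfl⟩, fun hc => hqC (basicClosed_mono _ ?_ hc)⟩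
    rintro x ⟨hx, hx'⟩ hxC
    exact hx' ⟨hx, hxC⟩

variable [ProperSpace X]

/-- If F maps into p, it is outside the Kuratowski closure of the preimage of the complement of p.
So some A ∈ F is coarsely disjoint from a B common to all ultrafilters over that complement, and U =
Bᶜ works. -/
theorem exists_basicOpen_le {p : Opens (Corona D.carrier)} {q : Corona D.carrier} (hq : q ∈ p) :
    ∃ U : Set X, q ∈ basicOpen D.carrier U ∧ basicOpen D.carrier U ≤ p := by
  obtain ⟨F, rfl⟩ := Quot.exists_rep q
  have hp : IsOpen (Quot.mk (CoronaRel (S := D.carrier)) ⁻¹' (p : Set (Corona D.carrier))) :=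
    p.isOpen.preimage continuous_quot_mk
  have hp' : kuratowskiClosure (Quot.mk (CoronaRel (S := D.carrier)) ⁻¹'
      (p : Set (Corona D.carrier)))ᶜ ⊆ (Quot.mk (CoronaRel (S := D.carrier)) ⁻¹'
        (p : Set (Corona D.carrier)))ᶜ := hp
  have hF : F ∉ kuratowskiClosure (Quot.mk (CoronaRel (S := D.carrier)) ⁻¹'
      (p : Set (Corona D.carrier)))ᶜ := fun h => hp' h hq
  change ¬ ∀ _, _ at hF
  push Not at hF
  obtain ⟨A, B, hA, hB, hAB⟩ := hF
  refine ⟨(Subtype.val '' B)ᶜ, fun h => hAB ?_, ?_⟩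
  · rw [compl_compl] at h
    exact h A (hA rfl)
  · rintro ⟨G⟩ hG
    by_contra hc
    refine hG ?_
    rw [compl_compl]
    exact close_self_of_mem G ((coronaRel_equivalence D).refl G) (hB hc) subset_rfl

/-- Regularity of ν(X), obtained by separating coarsely disjoint sets in X. -/
theorem exists_mem_basicOpen_and_basicClosed_subset {p : Opens (Corona D.carrier)}
    {q : Corona D.carrier} (hq : q ∈ p) :
    ∃ C : Set X, q ∈ basicOpen D.carrier C ∧ basicClosed D.carrier C ⊆ p := by
  obtain ⟨U, hqU, hUp⟩ := exists_basicOpen_le D hq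
  obtain ⟨F, rfl⟩ := Quot.exists_rep q
  change ¬ ∀ _, _ at hqU
  push Not at hqU
  obtain ⟨B, hB, hBU⟩ := hqU
  obtain ⟨C, h1, h2⟩ := exists_between hBU
  refine ⟨Cᶜ, ?_, ((basicClosed_subset_basicOpen_iff D).2 h2).trans hUp⟩
  intro h
  rw [compl_compl] at h
  exact h1 (h B hB)

theorem basicClosed_univ : basicClosed D.carrier Set.univ = Set.univ := by
  rw [Set.eq_univ_iff_forall]
  rintro ⟨F⟩
  exact close_self_of_mem F ((coronaRel_equivalence D).refl F) Filter.univ_mem (Set.subset_univ _)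

theorem basicOpen_subset_basicClosed (U : Set X) :
    (basicOpen D.carrier U : Set (Corona D.carrier)) ⊆ basicClosed D.carrier U := by
  intro q hq
  have := basicClosed_inter_basicOpen_subset (A := Set.univ)
    (by rw [basicClosed_univ]; trivial) hq
  rwa [Set.univ_inter] at this

/-- The Higson corona is the continuous image of the compact space of nonprincipal ultrafilters
with the topology induced from the Stone-Čech compactification of the Delone set. -/
instance compactSpace_corona : CompactSpace (Corona D.carrier) := by
  let P : Set (Ultrafilter D.carrier) := {F | ∀ s, F ≠ pure s}
  have hP : IsCompact P := by
    have : IsClosed P := by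
      have hP' : P = ⋂ s : D.carrier, {F : Ultrafilter D.carrier | {s}ᶜ ∈ F} := by
        ext F
        simp only [P, Set.mem_ofPred_eq, Set.mem_iInter, Ultrafilter.compl_mem_iff_notMem]
        refine forall_congr' fun s => not_congr ⟨?_, fun h => ?_⟩
        · rintro rfl
          exact Ultrafilter.mem_pure.2 rfl
        · obtain ⟨x, hx, rfl⟩ := Ultrafilter.eq_pure_of_finite_mem (Set.finite_singleton s) h
          rw [Set.mem_singleton_iff.1 hx]
      rw [hP']
      exact isClosed_iInter fun s => ultrafilter_isClosed_basic _
    exact this.isCompact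
  have hPc : CompactSpace P := isCompact_iff_compactSpace.1 hP
  let f : P → Corona D.carrier := fun F => Quot.mk _ ⟨F.1, F.2⟩
  have hf : Continuous f := by
    refine continuous_def.2 fun p hp => isOpen_iff_mem_nhds.2 fun F hF => ?_
    obtain ⟨U, hqU, hUp⟩ := exists_basicOpen_le D (p := ⟨p, hp⟩) hF
    change ¬ ∀ _, _ at hqU
    push Not at hqU
    obtain ⟨B, hB, hBU⟩ := hqU
    -- One member B of F that is coarsely disjoint from Uᶜ suffices: every ultrafilter containing B
    -- maps into O_U.
    refine Filter.mem_of_superset (((ultrafilter_isOpen_basic B).preimage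
      continuous_subtype_val).mem_nhds hB) fun G hG => hUp fun hc => hBU (hc B hG)
  have hs : Function.Surjective f := by
    rintro ⟨F⟩
    exact ⟨⟨F.1, F.2⟩, rfl⟩
  exact ⟨Set.range_eq_univ.2 hs ▸ isCompact_range hf⟩

/-- Compactness of A^ν, in the form used for choosing finitely many sets C with a local property. -/
theorem exists_finite_cover {A : Set X} {P : Set X → Prop}
    (h : ∀ q ∈ basicClosed D.carrier A, ∃ C, q ∈ basicOpen D.carrier C ∧ P C) :
    ∃ 𝒞 : Set (Set X), 𝒞.Finite ∧ (∀ C ∈ 𝒞, P C) ∧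
      ∀ q ∈ basicClosed D.carrier A, ∃ C ∈ 𝒞, q ∈ basicOpen D.carrier C := by
  obtain ⟨t, ht⟩ := (isClosed_basicClosed D.carrier A).isCompact.elim_finite_subcover
    (fun C : {C // P C} => (basicOpen D.carrier C.1 : Set (Corona D.carrier)))
    (fun C => (basicOpen D.carrier C.1).isOpen) (fun q hq => by
      obtain ⟨C, hqC, hC⟩ := h q hq
      exact Set.mem_iUnion.2 ⟨⟨C, hC⟩, hqC⟩)
  refine ⟨Subtype.val '' (t : Set {C // P C}), t.finite_toSet.image _, ?_, fun q hq => ?_⟩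
  · rintro _ ⟨C, -, rfl⟩
    exact C.2
  · obtain ⟨C, hC, hqC⟩ := Set.mem_iUnion₂.1 (ht hq)
    exact ⟨C, ⟨C, hC, rfl⟩, hqC⟩

/-- Cover A^ν by finitely many O_C with C^ν ⊆ p; the union of these C is the required U, because A ↦
A^ν commutes with finite unions. -/
theorem exists_basicClosed_subset_basicOpen_le {A : Set X} {p : Opens (Corona D.carrier)}
    (h : basicClosed D.carrier A ⊆ p) :
    ∃ U : Set X, ¬ Close A Uᶜ ∧ basicClosed D.carrier U ⊆ p := by
  obtain ⟨𝒞, hfin, hp, hcov⟩ := exists_finite_cover D (A := A)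
    (P := fun C => basicClosed D.carrier C ⊆ p)
    fun q hq => exists_mem_basicOpen_and_basicClosed_subset D (h hq)
  refine ⟨⋃ C ∈ 𝒞, C, (basicClosed_subset_basicOpen_iff D).1 fun q hq => ?_, fun q hq => ?_⟩
  · obtain ⟨C, hC, hqC⟩ := hcov q hq
    exact basicOpen_mono _ (Set.subset_biUnion_of_mem (u := fun C : Set X => C) hC) hqC
  · obtain ⟨C, hC, hqC⟩ := exists_mem_basicClosed_of_subset_biUnion hfin subset_rfl hq
    exact hp C hC hqC

theorem inner_iff {p : Opens (Corona D.carrier)} {A : Set X} :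
    Inner D.carrier p A ↔ basicClosed D.carrier A ⊆ p := by
  constructor
  · rintro ⟨U, hU, hA⟩
    exact ((basicClosed_subset_basicOpen_iff D).2 hA).trans hU
  · intro h
    obtain ⟨U, hA, hU⟩ := exists_basicClosed_subset_basicOpen_le D h
    exact ⟨U, (basicOpen_subset_basicClosed D U).trans hU, hA⟩

end Topology

/-! ### Restriction maps and gluing over coarse covers -/

section Restriction

variable {C : Type u} [Preorder C]

/-- The restriction map of a presheaf of abelian groups on a preorder. -/
abbrev res (F : Cᵒᵖ ⥤ AddCommGrpCat.{u}) {a b : C} (h : a ≤ b) :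
    F.obj (op b) ⟶ F.obj (op a) :=
  F.map (homOfLE h).op

theorem res_res (F : Cᵒᵖ ⥤ AddCommGrpCat.{u}) {a b c : C} (h : a ≤ b) (h' : b ≤ c)
    (s : F.obj (op c)) : res F h (res F h' s) = res F (h.trans h') s := by
  rw [← ConcreteCategory.comp_apply, ← F.map_comp]
  rfl

theorem res_rfl (F : Cᵒᵖ ⥤ AddCommGrpCat.{u}) {a : C} (s : F.obj (op a)) :
    res F le_rfl s = s := by
  have : F.map (homOfLE (le_refl a)).op = 𝟙 _ := F.map_id _
  rw [res, this]
  rfl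

end Restriction

section CoarseGluing

variable {X : Type u} [MetricSpace X]

/-- In a poset of subsets V ∩ W is the fibre product, so agreement there implies agreement on every
common subset, as the sheaf condition requires. -/
theorem IsCoarseCover.existsUnique_gluing {A : Set X} {𝒱 : Set (Set X)}
    (h : IsCoarseCover A 𝒱) (F : CoarseSheaf X) (x : ∀ V : 𝒱, F.obj.obj (op V.1))
    (hx : ∀ V W : 𝒱, res F.obj (Set.inter_subset_left : V.1 ∩ W.1 ⊆ V.1) (x V) =
      res F.obj (Set.inter_subset_right : V.1 ∩ W.1 ⊆ W.1) (x W)) :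
    ∃! t : F.obj.obj (op A), ∀ V : 𝒱, res F.obj (h.2.1 V.1 V.2) t = x V := by
  have hF := (isSheaf_iff_isSheaf_of_type _ _).1
    ((Presheaf.isSheaf_iff_isSheaf_forget (coarseTopology X) F.obj
      (CategoryTheory.forget AddCommGrpCat.{u})).1 F.property)
  have hcov : Sieve.generate (Presieve.ofArrows (fun V : 𝒱 => V.1)
      fun V => homOfLE (h.2.1 V.1 V.2)) ∈ coarseTopology X A := by
    refine ⟨𝒱, h, fun V hV => ⟨homOfLE (h.2.1 V hV), ?_⟩⟩
    exact Sieve.le_generate _ _ _ (Presieve.ofArrows.mk (⟨V, hV⟩ : 𝒱))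
  have := (Presieve.isSheafFor_arrows_iff _ _).1 ((Presieve.isSheafFor_iff_generate _).2
    (hF _ hcov))
  refine this x fun V W Z f g _ => ?_
  have hZ : Z ⊆ V.1 ∩ W.1 := Set.subset_inter (leOfHom f) (leOfHom g)
  have h1 := congrArg (res F.obj hZ) (hx V W)
  rw [res_res, res_res] at h1
  exact h1

theorem IsCoarseCover.hom_ext {A : Set X} {𝒱 : Set (Set X)}
    (h : IsCoarseCover A 𝒱) (F : CoarseSheaf X) {s t : F.obj.obj (op A)}
    (hst : ∀ V (hV : V ∈ 𝒱), res F.obj (h.2.1 V hV) s = res F.obj (h.2.1 V hV) t) : s = t := by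
  refine (h.existsUnique_gluing F (fun V => res F.obj (h.2.1 V.1 V.2) t) fun V W => ?_).unique
    (fun V => hst V.1 V.2) fun V => rfl
  rw [res_res, res_res]

end CoarseGluing

/-! ### The sheaf F^ν -/

section NuSections

variable {X : Type u} [MetricSpace X] {S : Set X} {F : (Set X)ᵒᵖ ⥤ AddCommGrpCat.{u}}

/-- The component at `A` of a section of `F^ν`. -/
def nuEval (F : (Set X)ᵒᵖ ⥤ AddCommGrpCat.{u}) {p : Opens (Corona S)} {A : Set X}
    (hA : Inner S p A) : ((nuPresheaf S).obj F).obj (op p) ⟶ F.obj (op A) :=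
  AddCommGrpCat.ofHom
    { toFun := fun s : nuSections S F p => s.1 ⟨A, hA⟩
      map_zero' := rfl
      map_add' := fun _ _ => rfl }

theorem Inner.mono_opens {p p' : Opens (Corona S)} {A : Set X} (hA : Inner S p A) (h : p ≤ p') :
    Inner S p' A :=
  hA.imp fun _ hU => ⟨hU.1.trans h, hU.2⟩

theorem Inner.mono_set {p : Opens (Corona S)} {A B : Set X} (hB : Inner S p B) (h : A ⊆ B) :
    Inner S p A :=
  hB.imp fun _ hU => ⟨hU.1, fun hc => hU.2 (hc.mono h subset_rfl)⟩

theorem nuEval_res {p p' : Opens (Corona S)} (h : p ≤ p') {A : Set X} (hA : Inner S p A)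
    (s : ((nuPresheaf S).obj F).obj (op p')) :
    nuEval F hA (((nuPresheaf S).obj F).map (homOfLE h).op s) = nuEval F (hA.mono_opens h) s :=
  rfl

theorem res_nuEval {p : Opens (Corona S)} {A B : Set X} (h : A ⊆ B) (hB : Inner S p B)
    (s : ((nuPresheaf S).obj F).obj (op p)) :
    res F h (nuEval F hB s) = nuEval F (hB.mono_set h) s :=
  Subtype.property (p := (· ∈ nuSections S F p)) s ⟨A, _⟩ ⟨B, hB⟩ (homOfLE h)

theorem nu_ext {p : Opens (Corona S)} {s t : ((nuPresheaf S).obj F).obj (op p)}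
    (h : ∀ A (hA : Inner S p A), nuEval F hA s = nuEval F hA t) : s = t :=
  Subtype.ext (funext fun A => h A.1 A.2)

/-- A section of `F^ν` given by a compatible family. -/
def nuMk {p : Opens (Corona S)} (x : ∀ A, Inner S p A → F.obj (op A))
    (hx : ∀ A B (h : A ⊆ B) (hB : Inner S p B), res F h (x B hB) = x A (hB.mono_set h)) :
    ((nuPresheaf S).obj F).obj (op p) :=
  (⟨fun A => x A.1 A.2, fun A B f => hx A.1 B.1 (leOfHom f) B.2⟩ : nuSections S F p)

end NuSections

section NuSheaf

variable {X : Type u} [MetricSpace X] [ProperSpace X] (D : Delone.DeloneSet X)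

/-- By compactness finitely many O_C cover A^ν, each with C^ν inside one p i; the sets A ∩ C form
the cover. -/
theorem exists_isCoarseCover_inner {ι : Type*} {p : ι → Opens (Corona D.carrier)} {A : Set X}
    (hA : Inner D.carrier (iSup p) A) :
    ∃ 𝒱 : Set (Set X), IsCoarseCover A 𝒱 ∧ ∀ V ∈ 𝒱, ∃ i, Inner D.carrier (p i) V := by
  rw [inner_iff] at hA
  obtain ⟨𝒞, hfin, hp, hcov⟩ := exists_finite_cover D (A := A)
    (P := fun C => ∃ i, basicClosed D.carrier C ⊆ p i) fun q hq => by
      obtain ⟨i, hi⟩ := Opens.mem_iSup.1 (hA hq)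
      obtain ⟨C, hqC, hC⟩ := exists_mem_basicOpen_and_basicClosed_subset D hi
      exact ⟨C, hqC, i, hC⟩
  refine ⟨_, isCoarseCover_image_inter D hfin hcov, ?_⟩
  rintro _ ⟨C, hC, rfl⟩
  obtain ⟨i, hi⟩ := hp C hC
  exact ⟨i, (inner_iff D).2 ((basicClosed_mono _ Set.inter_subset_right).trans hi)⟩

theorem nuPresheaf_isSheaf (F : CoarseSheaf X) :
    TopCat.Presheaf.IsSheaf ((nuPresheaf D.carrier).obj F.obj) := by
  refine (TopCat.Presheaf.isSheaf_iff_isSheafUniqueGluing _).2 fun ι p sf hsf => ?_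
  have hcomp : ∀ i j A (hi : Inner D.carrier (p i) A) (hj : Inner D.carrier (p j) A),
      nuEval F.obj hi (sf i) = nuEval F.obj hj (sf j) := by
    intro i j A hi hj
    -- `inner_iff` makes this immediate, whereas the definition provides two unrelated sets U, one
    -- for each i and j.
    have hij : Inner D.carrier (p i ⊓ p j) A := by
      rw [inner_iff] at hi hj ⊢
      exact Set.subset_inter hi hj
    exact congrArg (nuEval F.obj hij) (hsf i j)
  -- The component at A is glued over a chosen coarse cover, but it is characterised by all small B
  -- ⊆ A. Together with `huniq` this makes the components compatible whatever covers were chosen.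
  have key : ∀ A (hA : Inner D.carrier (iSup p) A), ∃ t : F.obj.obj (op A),
      ∀ i B (hBA : B ⊆ A) (hB : Inner D.carrier (p i) B),
        res F.obj hBA t = nuEval F.obj hB (sf i) := by
    intro A hA
    obtain ⟨𝒱, h𝒱, hi⟩ := exists_isCoarseCover_inner D hA
    choose i hi using hi
    obtain ⟨t, ht, -⟩ := h𝒱.existsUnique_gluing F
      (fun V => nuEval F.obj (hi V.1 V.2) (sf (i V.1 V.2))) fun V W => by
        rw [res_nuEval, res_nuEval]
        exact hcomp _ _ _ _ _
    refine ⟨t, fun j B hBA hB => ?_⟩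
    obtain ⟨h1, h2, h3⟩ := (isCoarseCover_iff_forall_mem_basicClosed D).1 h𝒱
    have hcov : IsCoarseCover B ((fun V => V ∩ B) '' 𝒱) := by
      refine (isCoarseCover_iff_forall_mem_basicClosed D).2 ⟨h1.image _, ?_, fun q hq => ?_⟩
      · rintro _ ⟨V, -, rfl⟩
        exact Set.inter_subset_right
      · obtain ⟨V, hV, hqV⟩ := h3 q (basicClosed_mono _ hBA hq)
        refine ⟨_, ⟨V, hV, rfl⟩, fun hc => hqV (basicClosed_mono _ ?_ hc)⟩
        rintro x ⟨hx, hx'⟩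
        exact ⟨hBA hx, fun hxV => hx' ⟨hxV, hx⟩⟩
    refine hcov.hom_ext F ?_
    rintro _ ⟨V, hV, rfl⟩
    have h4 := congrArg (res F.obj (Set.inter_subset_left : V ∩ B ⊆ V)) (ht ⟨V, hV⟩)
    rw [res_res, res_nuEval] at h4
    rw [res_res, res_nuEval]
    exact h4.trans (hcomp _ _ _ _ _)
  have huniq : ∀ A (hA : Inner D.carrier (iSup p) A) (t t' : F.obj.obj (op A)),
      (∀ i B (hBA : B ⊆ A), Inner D.carrier (p i) B → res F.obj hBA t = res F.obj hBA t') →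
        t = t' := by
    intro A hA t t' htt'
    obtain ⟨𝒱, h𝒱, hi⟩ := exists_isCoarseCover_inner D hA
    refine h𝒱.hom_ext F fun V hV => ?_
    obtain ⟨i, hi⟩ := hi V hV
    exact htt' i V _ hi
  choose t ht using key
  refine ⟨nuMk t fun A B hAB hB => ?_, fun i => ?_, fun t' ht' => ?_⟩
  · refine huniq A (hB.mono_set hAB) _ _ fun i C hCA hC => ?_
    rw [res_res, ht _ _ i C _ hC, ht _ _ i C _ hC]
  · refine nu_ext fun A hA => ?_
    have := ht A (hA.mono_opens (le_iSup p i)) i A subset_rfl hA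
    rw [res_rfl] at this
    exact this
  · refine nu_ext fun A hA => huniq A hA _ _ fun i B hBA hB => ?_
    rw [res_nuEval, res_nuEval]
    refine Eq.trans ?_ ((ht A hA i B hBA hB).symm.trans ?_)
    · exact congrArg (nuEval F.obj hB) (ht' i)
    · exact res_nuEval hBA hA (nuMk t _)

end NuSheaf

/-! ### Pointwise comparison of sections of a sheaf -/

section LocEq

variable {Y : TopCat.{u}}

/-- Sections `s` and `t` of a presheaf have the same germ at `z`. -/
def LocEq (G : TopCat.Presheaf AddCommGrpCat.{u} Y) {P Q : Opens Y} (s : G.obj (op P))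
    (t : G.obj (op Q)) (z : Y) : Prop :=
  ∃ (N : Opens Y) (hP : N ≤ P) (hQ : N ≤ Q), z ∈ N ∧ res G hP s = res G hQ t

variable {G : TopCat.Presheaf AddCommGrpCat.{u} Y} {P Q R : Opens Y} {s : G.obj (op P)}
  {t : G.obj (op Q)} {r : G.obj (op R)} {z : Y}

theorem LocEq.symm (h : LocEq G s t z) : LocEq G t s z := by
  obtain ⟨N, hP, hQ, hz, hst⟩ := h
  exact ⟨N, hQ, hP, hz, hst.symm⟩

theorem LocEq.trans (h : LocEq G s t z) (h' : LocEq G t r z) : LocEq G s r z := by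
  obtain ⟨N, hP, hQ, hz, hst⟩ := h
  obtain ⟨N', hQ', hR, hz', htr⟩ := h'
  refine ⟨N ⊓ N', inf_le_left.trans hP, inf_le_right.trans hR, ⟨hz, hz'⟩, ?_⟩
  rw [← res_res G inf_le_left hP, hst, ← res_res G inf_le_right hR, ← htr, res_res, res_res]

theorem locEq_res (h : P ≤ Q) (t : G.obj (op Q)) (hz : z ∈ P) : LocEq G (res G h t) t z :=
  ⟨P, le_rfl, h, hz, res_rfl _ _⟩

theorem isOpen_locEq (s : G.obj (op P)) (t : G.obj (op Q)) : IsOpen {z | LocEq G s t z} := by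
  refine isOpen_iff_forall_mem_open.2 ?_
  rintro z ⟨N, hP, hQ, hz, hst⟩
  exact ⟨N, fun w hw => ⟨N, hP, hQ, hw, hst⟩, N.isOpen, hz⟩

theorem eq_of_forall_locEq (G : TopCat.Sheaf AddCommGrpCat.{u} Y) {s t : G.obj.obj (op P)}
    (h : ∀ z ∈ P, LocEq G.obj s t z) : s = t := by
  choose! N hP hQ hz hst using h
  refine G.eq_of_locally_eq' (fun z : P => N z.1) P (fun z => homOfLE (hP z.1 z.2))
    (fun z hzP => Opens.mem_iSup.2 ⟨⟨z, hzP⟩, hz z hzP⟩) s t fun z => hst z.1 z.2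

/-- The sections live on Q k but need to agree only on the smaller sets p k. This allows
representatives of germs with unrelated domains to be glued after shrinking. -/
theorem exists_glue (G : TopCat.Sheaf AddCommGrpCat.{u} Y) {ι : Type*} {p Q : ι → Opens Y}
    (hpQ : ∀ k, p k ≤ Q k) (s : ∀ k, G.obj.obj (op (Q k)))
    (h : ∀ k l, ∀ z ∈ p k, z ∈ p l → LocEq G.obj (s k) (s l) z) :
    ∃ t : G.obj.obj (op (iSup p)), ∀ k, ∀ z ∈ p k, LocEq G.obj t (s k) z := by
  obtain ⟨t, ht, -⟩ := G.existsUnique_gluing p (fun k => res G.obj (hpQ k) (s k)) fun k l => by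
    refine eq_of_forall_locEq G fun z hz => ?_
    exact (locEq_res inf_le_left _ hz).trans ((locEq_res (hpQ k) _ hz.1).trans
      ((h k l z hz.1 hz.2).trans ((locEq_res inf_le_right _ hz).trans
        (locEq_res (hpQ l) _ hz.2)).symm))
  refine ⟨t, fun k z hz => ?_⟩
  exact (locEq_res (le_iSup p k) t hz).symm.trans (by
    rw [show res G.obj (le_iSup p k) t = res G.obj (hpQ k) (s k) from ht k]
    exact locEq_res (hpQ k) _ hz)

end LocEq

/-! ### Ĝ as germs along basic closed sets, and its sheaf property -/

section Germs

variable {X : Type u} [MetricSpace X]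

instance coarseNhd_isCodirectedOrder (A : Set X) : IsCodirectedOrder (CoarseNhd A) :=
  ⟨fun U V => ⟨⟨U.1 ∩ V.1, by
    rw [Set.compl_inter]
    exact not_close_union U.2 V.2⟩, Set.inter_subset_left, Set.inter_subset_right⟩⟩

instance coarseNhd_isFiltered (A : Set X) : IsFiltered (CoarseNhd A)ᵒᵖ := by
  have h1 : Nonempty (CoarseNhd A) := ⟨⟨Set.univ, by
    rw [Set.compl_univ]
    exact not_close_empty A⟩⟩
  infer_instance

variable {S : Set X} (G : TopCat.Presheaf AddCommGrpCat.{u} (TopCat.of (Corona S)))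

theorem hatMk_res {A : Set X} {U V : CoarseNhd A} (h : U ≤ V)
    (s : G.obj (op (basicOpen S V.1))) :
    hatMk S G A U (res G (basicOpen_mono S h) s) = hatMk S G A V s := by
  have := colimit.w (coarseNhdToOpens S A ⋙ G) (homOfLE h).op
  exact ConcreteCategory.congr_hom this s

theorem exists_hatMk {A : Set X} (x : hatObj S G A) :
    ∃ (U : CoarseNhd A) (s : G.obj (op (basicOpen S U.1))), hatMk S G A U s = x := by
  obtain ⟨U, s, h⟩ := Concrete.colimit_exists_rep (coarseNhdToOpens S A ⋙ G) x
  exact ⟨U.unop, s, h⟩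

theorem exists_of_hatMk_eq {A : Set X} {U V : CoarseNhd A}
    {s : G.obj (op (basicOpen S U.1))} {t : G.obj (op (basicOpen S V.1))}
    (h : hatMk S G A U s = hatMk S G A V t) :
    ∃ (W : CoarseNhd A) (hU : W ≤ U) (hV : W ≤ V),
      res G (basicOpen_mono S hU) s = res G (basicOpen_mono S hV) t := by
  obtain ⟨W, f, g, h⟩ := Concrete.colimit_exists_of_rep_eq (coarseNhdToOpens S A ⋙ G) s t h
  exact ⟨W.unop, leOfHom f.unop, leOfHom g.unop, h⟩

end Germs

section Hat

variable {X : Type u} [MetricSpace X] [ProperSpace X] (D : Delone.DeloneSet X)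

theorem exists_coarseNhd_basicOpen_le {A : Set X} {P : Opens (Corona D.carrier)}
    (h : basicClosed D.carrier A ⊆ P) : ∃ U : CoarseNhd A, basicOpen D.carrier U.1 ≤ P := by
  obtain ⟨U, hU, hP⟩ := exists_basicClosed_subset_basicOpen_le D h
  exact ⟨⟨U, hU⟩, (basicOpen_subset_basicClosed D U).trans hP⟩

/-- The class in `Ĝ(A)` of a section of `G` over an open set that contains the basic closed set
of `A`. -/
noncomputable def germ (G : TopCat.Presheaf AddCommGrpCat.{u} (TopCat.of (Corona D.carrier)))
    {A : Set X} {P : Opens (Corona D.carrier)} (h : basicClosed D.carrier A ⊆ P) :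
    G.obj (op P) ⟶ ((hatPresheaf D.carrier).obj G).obj (op A) :=
  res G (exists_coarseNhd_basicOpen_le D h).choose_spec ≫
    hatMk D.carrier G A (exists_coarseNhd_basicOpen_le D h).choose

section Presheaf

variable (G : TopCat.Presheaf AddCommGrpCat.{u} (TopCat.of (Corona D.carrier)))
  {A : Set X} {P Q : Opens (Corona D.carrier)}

/-- Two coarse neighbourhoods have a common refinement, so the choice made in `germ` is irrelevant.
-/
theorem germ_eq_hatMk (hP : basicClosed D.carrier A ⊆ P) (U : CoarseNhd A)
    (hU : basicOpen D.carrier U.1 ≤ P) (s : G.obj (op P)) :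
    germ D G hP s = hatMk D.carrier G A U (res G hU s) := by
  have hV := (exists_coarseNhd_basicOpen_le D hP).choose_spec
  change hatMk D.carrier G A _ (res G hV s) = _
  obtain ⟨W, h1, h2⟩ := directed_of (· ≥ ·) U (exists_coarseNhd_basicOpen_le D hP).choose
  rw [← hatMk_res G h1, ← hatMk_res G h2, res_res, res_res]

theorem hatMk_eq_germ (U : CoarseNhd A) (s : G.obj (op (basicOpen D.carrier U.1))) :
    hatMk D.carrier G A U s = germ D G ((basicClosed_subset_basicOpen_iff D).2 U.2) s := by
  rw [germ_eq_hatMk D G _ U le_rfl, res_rfl]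

theorem germ_res (hP : basicClosed D.carrier A ⊆ P) (h : P ≤ Q) (s : G.obj (op Q)) :
    germ D G hP (res G h s) = germ D G (hP.trans h) s := by
  obtain ⟨U, hU⟩ := exists_coarseNhd_basicOpen_le D hP
  rw [germ_eq_hatMk D G _ U hU, germ_eq_hatMk D G _ U (hU.trans h), res_res]

theorem exists_germ (x : ((hatPresheaf D.carrier).obj G).obj (op A)) :
    ∃ (P : Opens (Corona D.carrier)) (h : basicClosed D.carrier A ⊆ P) (s : G.obj (op P)),
      germ D G h s = x := by
  obtain ⟨U, s, h⟩ := exists_hatMk G x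
  exact ⟨_, _, s, (hatMk_eq_germ D G U s).symm.trans h⟩

theorem res_germ {B : Set X} (h : A ⊆ B) (hB : basicClosed D.carrier B ⊆ P) (s : G.obj (op P)) :
    res ((hatPresheaf D.carrier).obj G) h (germ D G hB s) =
      germ D G ((basicClosed_mono _ h).trans hB) s := by
  obtain ⟨U, hU⟩ := exists_coarseNhd_basicOpen_le D hB
  rw [germ_eq_hatMk D G hB U hU, germ_eq_hatMk D G _ ⟨U.1, not_close_of_hom (homOfLE h) U⟩ hU]
  exact ConcreteCategory.congr_hom (hatMk_hatRestrict D.carrier G (homOfLE h) U) _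

theorem locEq_of_germ_eq {hP : basicClosed D.carrier A ⊆ P} {hQ : basicClosed D.carrier A ⊆ Q}
    {s : G.obj (op P)} {t : G.obj (op Q)} (h : germ D G hP s = germ D G hQ t)
    (z : Corona D.carrier) (hz : z ∈ basicClosed D.carrier A) : LocEq G s t z := by
  obtain ⟨U, hU'⟩ := exists_coarseNhd_basicOpen_le D hP
  obtain ⟨V, hV'⟩ := exists_coarseNhd_basicOpen_le D hQ
  rw [germ_eq_hatMk D G hP U hU', germ_eq_hatMk D G hQ V hV'] at h
  obtain ⟨W, hU, hV, hst⟩ := exists_of_hatMk_eq G h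
  rw [res_res, res_res] at hst
  exact ⟨_, _, _, (basicClosed_subset_basicOpen_iff D).2 W.2 hz, hst⟩

end Presheaf

section Sheaf

variable (G : TopCat.Sheaf AddCommGrpCat.{u} (TopCat.of (Corona D.carrier)))
  {A : Set X} {P Q : Opens (Corona D.carrier)}

/-- The points where s and t agree locally form an open set. If it contains A^ν, then s and t agree
on a whole neighbourhood of A^ν by separatedness. -/
theorem germ_eq_iff {hP : basicClosed D.carrier A ⊆ P} {hQ : basicClosed D.carrier A ⊆ Q}
    {s : G.obj.obj (op P)} {t : G.obj.obj (op Q)} :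
    germ D G.obj hP s = germ D G.obj hQ t ↔
      ∀ z ∈ basicClosed D.carrier A, LocEq G.obj s t z := by
  refine ⟨locEq_of_germ_eq D G.obj, fun h => ?_⟩
  let R : Opens (Corona D.carrier) := ⟨{z | LocEq G.obj s t z}, isOpen_locEq s t⟩ ⊓ (P ⊓ Q)
  have hR : basicClosed D.carrier A ⊆ R := fun z hz => ⟨h z hz, hP hz, hQ hz⟩
  have hRP : R ≤ P := inf_le_right.trans inf_le_left
  have hRQ : R ≤ Q := inf_le_right.trans inf_le_right
  rw [← germ_res D G.obj hR hRP, ← germ_res D G.obj hR hRQ]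
  refine congrArg _ (eq_of_forall_locEq G fun z hz => ?_)
  exact (locEq_res hRP s hz).trans (LocEq.trans hz.1 (locEq_res hRQ t hz).symm)

theorem hat_ext {x y : ((hatPresheaf D.carrier).obj G.obj).obj (op A)}
    (h : ∀ z ∈ basicClosed D.carrier A, ∃ (B : Set X) (hB : B ⊆ A), z ∈ basicClosed D.carrier B ∧
      res ((hatPresheaf D.carrier).obj G.obj) hB x =
        res ((hatPresheaf D.carrier).obj G.obj) hB y) : x = y := by
  obtain ⟨P, hP, s, rfl⟩ := exists_germ D G.obj x
  obtain ⟨Q, hQ, t, rfl⟩ := exists_germ D G.obj y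
  refine (germ_eq_iff D G).2 fun z hz => ?_
  obtain ⟨B, hB, hzB, hst⟩ := h z hz
  rw [res_germ, res_germ] at hst
  exact (germ_eq_iff D G).1 hst z hzB

/-- The compatibility of x V and x W controls their representatives only on (V ∩ W)^ν, which may be
smaller than V^ν ∩ W^ν. The representatives are therefore used on smaller sets C^ν that avoid (A \
V)^ν, and glued on an open set Ω around A^ν where they agree. -/
theorem hat_exists_glue {𝒱 : Set (Set X)} (h : IsCoarseCover A 𝒱)
    (x : ∀ V : 𝒱, ((hatPresheaf D.carrier).obj G.obj).obj (op V.1))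
    (hx : ∀ V W : 𝒱, res _ (Set.inter_subset_left : V.1 ∩ W.1 ⊆ V.1) (x V) =
      res _ (Set.inter_subset_right : V.1 ∩ W.1 ⊆ W.1) (x W)) :
    ∃ t : ((hatPresheaf D.carrier).obj G.obj).obj (op A),
      ∀ V : 𝒱, res _ (h.2.1 V.1 V.2) t = x V := by
  choose P hP s hs using fun V => exists_germ D G.obj (x V)
  have hloc : ∀ V W : 𝒱, ∀ z ∈ basicClosed D.carrier (V.1 ∩ W.1), LocEq G.obj (s V) (s W) z := by
    intro V W z hz
    have := hx V W
    rw [← hs, ← hs, res_germ, res_germ] at this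
    exact (germ_eq_iff D G).1 this z hz
  have h3 := ((isCoarseCover_iff_forall_mem_basicClosed D).1 h).2.2
  obtain ⟨𝒞, hfin, hC, hcov⟩ := exists_finite_cover D (A := A)
    (P := fun C => ∃ V : 𝒱, basicClosed D.carrier C ⊆
      (P V ⊓ ⟨(basicClosed D.carrier (A \ V.1))ᶜ, (isClosed_basicClosed _ _).isOpen_compl⟩ :
        Opens (Corona D.carrier)))
    fun q hq => by
      obtain ⟨V, hV, hqV⟩ := h3 q hq
      have hqV' := (mem_basicClosed_diff_or_inter V hq).resolve_left hqV
      obtain ⟨C, hqC, hC⟩ := exists_mem_basicOpen_and_basicClosed_subset D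
        (p := P ⟨V, hV⟩ ⊓ ⟨(basicClosed D.carrier (A \ V))ᶜ,
          (isClosed_basicClosed _ _).isOpen_compl⟩) (q := q)
        ⟨hP ⟨V, hV⟩ (basicClosed_mono _ Set.inter_subset_right hqV'), hqV⟩
      exact ⟨C, hqC, ⟨V, hV⟩, hC⟩
  choose v hv using fun C : 𝒞 => hC C.1 C.2
  have : Finite 𝒞 := hfin
  -- Ω is the complement of the finitely many closed sets of points of k^ν ∩ l^ν at which the
  -- sections for k and l differ.
  let Ω : Opens (Corona D.carrier) :=
    ⟨⋂ k : 𝒞, ⋂ l : 𝒞, ({z | LocEq G.obj (s (v k)) (s (v l)) z} ∪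
      ((basicClosed D.carrier k.1)ᶜ ∪ (basicClosed D.carrier l.1)ᶜ)),
      isOpen_iInter_of_finite fun k => isOpen_iInter_of_finite fun l =>
        (isOpen_locEq (G := G.obj) (s (v k)) (s (v l))).union
          ((isClosed_basicClosed _ _).isOpen_compl.union
          (isClosed_basicClosed _ _).isOpen_compl)⟩
  have hΩ : ∀ z ∈ Ω, ∀ k l : 𝒞, z ∈ basicClosed D.carrier k.1 → z ∈ basicClosed D.carrier l.1 →
      LocEq G.obj (s (v k)) (s (v l)) z := by
    intro z hz k l hk hl
    rcases Set.mem_iInter.1 (Set.mem_iInter.1 hz k) l with h | h | h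
    · exact h
    · exact absurd hk h
    · exact absurd hl h
  -- Since k^ν avoids (A \ v k)^ν, its points in B^ν come from B ∩ v k. Applied twice, this puts the
  -- points of A^ν ∩ k^ν ∩ l^ν into (v k ∩ v l)^ν, so A^ν ⊆ Ω.
  have hinter : ∀ B ⊆ A, ∀ k : 𝒞, ∀ z ∈ basicClosed D.carrier B, z ∈ basicClosed D.carrier k.1 →
      z ∈ basicClosed D.carrier (B ∩ (v k).1) := by
    intro B hBA k z hzB hzk
    exact (mem_basicClosed_diff_or_inter _ hzB).resolve_left fun hc =>
      (hv k hzk).2 (basicClosed_mono _ (Set.sdiff_subset_sdiff_left hBA) hc)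
  obtain ⟨t, ht⟩ := exists_glue G (p := fun k : 𝒞 => basicOpen D.carrier k.1 ⊓ Ω)
    (Q := fun k => P (v k))
    (fun k => inf_le_left.trans fun z hz => (hv k (basicOpen_subset_basicClosed D _ hz)).1)
    (fun k => s (v k)) fun k l z hk hl => hΩ z hk.2 k l
      (basicOpen_subset_basicClosed D _ hk.1) (basicOpen_subset_basicClosed D _ hl.1)
  have hmem : ∀ z ∈ basicClosed D.carrier A, ∃ k : 𝒞, z ∈ basicOpen D.carrier k.1 ⊓ Ω := by
    intro z hz
    obtain ⟨C, hC, hzC⟩ := hcov z hz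
    refine ⟨⟨C, hC⟩, hzC, Set.mem_iInter.2 fun k => Set.mem_iInter.2 fun l => ?_⟩
    by_cases hk : z ∈ basicClosed D.carrier k.1
    · by_cases hl : z ∈ basicClosed D.carrier l.1
      · left
        refine hloc _ _ z (hinter _ (h.2.1 _ (v k).2) l z ?_ hl)
        exact basicClosed_mono _ Set.inter_subset_right (hinter A subset_rfl k z hz hk)
      · exact Or.inr (Or.inr hl)
    · exact Or.inr (Or.inl hk)
  refine ⟨germ D G.obj (fun z hz => Opens.mem_iSup.2 (hmem z hz)) t, fun V => ?_⟩
  refine (res_germ D G.obj _ _ t).trans (Eq.trans ?_ (hs V))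
  refine (germ_eq_iff D G).2 fun z hz => ?_
  obtain ⟨k, hk⟩ := hmem z (basicClosed_mono _ (h.2.1 V.1 V.2) hz)
  refine (ht k z hk).trans (hloc V (v k) z ?_).symm
  exact hinter V.1 (h.2.1 V.1 V.2) k z hz (basicOpen_subset_basicClosed D _ hk.1)

theorem hatPresheaf_isSheaf :
    Presheaf.IsSheaf (coarseTopology X) ((hatPresheaf D.carrier).obj G.obj) := by
  refine (Presheaf.isSheaf_iff_isSheaf_forget _ _ (CategoryTheory.forget AddCommGrpCat.{u})).2
    ((isSheaf_iff_isSheaf_of_type _ _).2 ?_)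
  intro A T hT x hx
  obtain ⟨𝒱, h𝒱, hT⟩ := hT
  choose f hf using hT
  have h3 := ((isCoarseCover_iff_forall_mem_basicClosed D).1 h𝒱).2.2
  have hxr : ∀ {B C E : Set X} (g : B ⟶ A) (g' : C ⟶ A) (hg : T g) (hg' : T g') (hB : E ⊆ B)
      (hC : E ⊆ C), res ((hatPresheaf D.carrier).obj G.obj) hB (x g hg) =
        res ((hatPresheaf D.carrier).obj G.obj) hC (x g' hg') :=
    fun g g' hg hg' hB hC => hx (homOfLE hB) (homOfLE hC) hg hg' rfl
  obtain ⟨t, ht⟩ := hat_exists_glue D G h𝒱 (fun V => x (f V.1 V.2) (hf V.1 V.2))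
    fun V W => hxr _ _ _ _ _ _
  -- The section is glued over the coarse cover only. Separatedness over every B ⊆ A is what
  -- identifies its restrictions to the other members of the sieve.
  have hsep : ∀ {B : Set X} (hB : B ⊆ A) (y y' : ((hatPresheaf D.carrier).obj G.obj).obj (op B)),
      (∀ V ∈ 𝒱, res ((hatPresheaf D.carrier).obj G.obj) (Set.inter_subset_left : B ∩ V ⊆ B) y =
        res ((hatPresheaf D.carrier).obj G.obj) (Set.inter_subset_left : B ∩ V ⊆ B) y') →
      y = y' := by
    intro B hB y y' hyy'
    refine hat_ext D G fun z hz => ?_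
    obtain ⟨V, hV, hzV⟩ := h3 z (basicClosed_mono _ hB hz)
    refine ⟨B ∩ V, Set.inter_subset_left, ?_, hyy' V hV⟩
    exact (mem_basicClosed_diff_or_inter V hz).resolve_left fun hc =>
      hzV (basicClosed_mono _ (Set.sdiff_subset_sdiff_left hB) hc)
  refine ⟨t, fun B g hg => hsep (leOfHom g) _ _ fun V hV => ?_, fun t' ht' => ?_⟩
  · have h1 := congrArg (res ((hatPresheaf D.carrier).obj G.obj)
      (Set.inter_subset_right : B ∩ V ⊆ V)) (ht ⟨V, hV⟩)
    rw [res_res] at h1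
    refine (res_res _ _ (leOfHom g) t).trans (h1.trans ?_)
    exact hxr _ _ _ _ _ _
  · refine hsep subset_rfl _ _ fun V hV => ?_
    have h1 : res ((hatPresheaf D.carrier).obj G.obj) (h𝒱.2.1 V hV) t' =
        res ((hatPresheaf D.carrier).obj G.obj) (h𝒱.2.1 V hV) t :=
      (ht' (f V hV) (hf V hV)).trans (ht ⟨V, hV⟩).symm
    have h2 := congrArg (res ((hatPresheaf D.carrier).obj G.obj)
      (Set.inter_subset_right : A ∩ V ⊆ V)) h1
    rwa [res_res, res_res] at h2

end Sheaf

end Hat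

/-! ### Reflectivity in terms of elements -/

section Reflective

variable {X : Type u} [MetricSpace X]

theorem res_injective_of_isBounded (F : CoarseSheaf X) {V A : Set X} (h : V ⊆ A)
    (hb : Bornology.IsBounded (A \ V)) : Function.Injective (res F.obj h) := by
  have := isIso_map_of_isBounded F (homOfLE h) hb
  exact ((ConcreteCategory.isIso_iff_bijective _).1 this).1

/-- Restriction to A ∩ U is injective because A \ U is bounded; testing there eliminates the inverse
in `coarseRestrict`. -/
theorem coarseRestrict_eq_iff (F : CoarseSheaf X) {A : Set X} {U : CoarseNhd A}
    {y : F.obj.obj (op U.1)} {x : F.obj.obj (op A)} :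
    coarseRestrict F A U y = x ↔ res F.obj (Set.inter_subset_right : A ∩ U.1 ⊆ U.1) y =
      res F.obj (Set.inter_subset_left : A ∩ U.1 ⊆ A) x := by
  have h : res F.obj (Set.inter_subset_left : A ∩ U.1 ⊆ A) (coarseRestrict F A U y) =
      res F.obj (Set.inter_subset_right : A ∩ U.1 ⊆ U.1) y :=
    ConcreteCategory.congr_hom (coarseRestrict_comp F A U) y
  rw [← h]
  refine ⟨fun h => congrArg _ h, fun h => res_injective_of_isBounded F _ ?_ h⟩
  rw [Set.sdiff_self_inter, Set.sdiff_eq]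
  exact isBounded_inter U.2

theorem res_coarseRestrict (F : CoarseSheaf X) {A B : Set X} (h : B ⊆ A) (U : CoarseNhd A)
    (y : F.obj.obj (op U.1)) :
    res F.obj h (coarseRestrict F A U y) =
      coarseRestrict F B ⟨U.1, not_close_of_hom (homOfLE h) U⟩ y := by
  refine ((coarseRestrict_eq_iff F).2 ?_).symm
  have h1 := congrArg (res F.obj (Set.inter_subset_inter_left U.1 h))
    ((coarseRestrict_eq_iff F (y := y)).1 rfl)
  rw [res_res, res_res] at h1
  rw [res_res]
  exact h1

theorem coarseRestrict_res (F : CoarseSheaf X) {A : Set X} {U V : CoarseNhd A} (h : V ≤ U)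
    (y : F.obj.obj (op U.1)) :
    coarseRestrict F A V (res F.obj h y) = coarseRestrict F A U y := by
  refine (coarseRestrict_eq_iff F).2 ?_
  have h1 := congrArg (res F.obj (Set.inter_subset_inter_right A h))
    ((coarseRestrict_eq_iff F (y := y)).1 rfl)
  rw [res_res, res_res] at h1
  rw [res_res]
  exact h1

/-- The colimit is filtered: surjectivity means that elements extend to a coarse neighbourhood,
injectivity that equality does. -/
theorem isReflective_iff (F : CoarseSheaf X) :
    IsReflective F ↔ ∀ A : Set X,
      (∀ x : F.obj.obj (op A), ∃ (U : CoarseNhd A) (y : F.obj.obj (op U.1)),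
        coarseRestrict F A U y = x) ∧
      ∀ (U : CoarseNhd A) (y y' : F.obj.obj (op U.1)),
        coarseRestrict F A U y = coarseRestrict F A U y' →
          ∃ (V : CoarseNhd A) (h : V ≤ U), res F.obj h y = res F.obj h y' := by
  refine forall_congr' fun A => ?_
  have hι : ∀ (U : CoarseNhd A) (y : F.obj.obj (op U.1)),
      reflectionMap F A (colimit.ι (coarseNhdToSet A ⋙ F.obj) (op U) y) =
        coarseRestrict F A U y := by
    intro U y
    have h : colimit.ι (coarseNhdToSet A ⋙ F.obj) (op U) ≫ reflectionMap F A =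
      coarseRestrict F A U := colimit.ι_desc _ _
    exact ConcreteCategory.congr_hom h y
  rw [ConcreteCategory.isIso_iff_bijective]
  constructor
  · refine fun hb => ⟨fun x => ?_, fun U y y' h => ?_⟩
    · obtain ⟨c, rfl⟩ := hb.2 x
      obtain ⟨U, y, rfl⟩ := Concrete.colimit_exists_rep (coarseNhdToSet A ⋙ F.obj) c
      exact ⟨U.unop, y, (hι _ _).symm⟩
    · rw [← hι, ← hι] at h
      obtain ⟨V, f, g, hfg⟩ :=
        Concrete.colimit_exists_of_rep_eq (coarseNhdToSet A ⋙ F.obj) _ _ (hb.1 h)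
      rw [Subsingleton.elim g f] at hfg
      exact ⟨V.unop, leOfHom f.unop, hfg⟩
  · rintro ⟨hs, hi⟩
    refine ⟨fun c c' h => ?_, fun x => ?_⟩
    · obtain ⟨U, y, rfl⟩ := Concrete.colimit_exists_rep (coarseNhdToSet A ⋙ F.obj) c
      obtain ⟨V, y', rfl⟩ := Concrete.colimit_exists_rep (coarseNhdToSet A ⋙ F.obj) c'
      have h' : coarseRestrict F A U.unop y = coarseRestrict F A V.unop y' :=
        (hι _ _).symm.trans (h.trans (hι _ _))
      obtain ⟨W, h1, h2⟩ := directed_of (· ≥ ·) U.unop V.unop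
      obtain ⟨W', hW', h3⟩ := hi W (res F.obj h1 y) (res F.obj h2 y')
        ((coarseRestrict_res F h1 y).trans (h'.trans (coarseRestrict_res F h2 y').symm))
      exact Concrete.colimit_rep_eq_of_exists (coarseNhdToSet A ⋙ F.obj) _ _
        ⟨op W', (homOfLE (hW'.trans h1)).op, (homOfLE (hW'.trans h2)).op,
          (res_res F.obj _ _ y).symm.trans (h3.trans (res_res F.obj _ _ y'))⟩
    · obtain ⟨U, y, rfl⟩ := hs x
      exact ⟨_, hι U y⟩

theorem isReflective_of_iso {F F' : CoarseSheaf X} (e : F ≅ F') (h : IsReflective F) :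
    IsReflective F' := by
  have hnat : ∀ {A B : Set X} (hAB : A ⊆ B) (x : F.obj.obj (op B)),
      res F'.obj hAB (e.hom.hom.app _ x) = e.hom.hom.app _ (res F.obj hAB x) :=
    fun hAB x => (ConcreteCategory.congr_hom (e.hom.hom.naturality (homOfLE hAB).op) x).symm
  have hcr : ∀ {A : Set X} (U : CoarseNhd A) (y : F.obj.obj (op U.1)),
      coarseRestrict F' A U (e.hom.hom.app _ y) = e.hom.hom.app _ (coarseRestrict F A U y) := by
    intro A U y
    rw [coarseRestrict_eq_iff, hnat, hnat, (coarseRestrict_eq_iff F).1 rfl]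
  have hiso : IsIso e.hom.hom := inferInstanceAs (IsIso ((sheafToPresheaf _ _).map e.hom))
  have hbij : ∀ A : Set X, Function.Bijective (e.hom.hom.app (op A)) := fun A =>
    (ConcreteCategory.isIso_iff_bijective _).1 inferInstance
  rw [isReflective_iff] at h ⊢
  refine fun A => ⟨fun x => ?_, fun U y y' hyy' => ?_⟩
  · obtain ⟨x, rfl⟩ := (hbij A).2 x
    obtain ⟨U, y, rfl⟩ := (h A).1 x
    exact ⟨U, _, hcr U y⟩
  · obtain ⟨y, rfl⟩ := (hbij _).2 y
    obtain ⟨y', rfl⟩ := (hbij _).2 y'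
    rw [hcr, hcr] at hyy'
    obtain ⟨V, hV, hV'⟩ := (h A).2 U y y' ((hbij _).1 hyy')
    exact ⟨V, hV, by rw [hnat, hnat, hV']⟩

end Reflective

/-! ### The adjunction, the equivalence and constant sheaves -/

section Adjunction

variable {X : Type u} [MetricSpace X]

/-- The map from the hat of `F^ν` at `A` to `F(A)` that takes the class of a compatible family to
its component at `A`. -/
noncomputable def counitApp (S : Set X) (F : (Set X)ᵒᵖ ⥤ AddCommGrpCat.{u}) (A : Set X) :
    hatObj S ((nuPresheaf S).obj F) A ⟶ F.obj (op A) :=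
  colimit.desc (coarseNhdToOpens S A ⋙ (nuPresheaf S).obj F)
    { pt := F.obj (op A)
      ι :=
        { app := fun U => nuEval F ⟨U.unop.1, le_rfl, U.unop.2⟩
          naturality := fun _ _ _ => rfl } }

theorem hatMk_counitApp (S : Set X) (F : (Set X)ᵒᵖ ⥤ AddCommGrpCat.{u}) (A : Set X)
    (U : CoarseNhd A) :
    hatMk S ((nuPresheaf S).obj F) A U ≫ counitApp S F A = nuEval F ⟨U.1, le_rfl, U.2⟩ :=
  colimit.ι_desc _ _

/-- The map from the hat of `F^ν` to `F`. -/
noncomputable def counitMap (S : Set X) (F : (Set X)ᵒᵖ ⥤ AddCommGrpCat.{u}) :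
    (hatPresheaf S).obj ((nuPresheaf S).obj F) ⟶ F where
  app A := counitApp S F A.unop
  naturality B A i := hat_hom_ext fun U => by
    change hatMk S _ B.unop U ≫ hatRestrict S _ i.unop ≫ counitApp S F A.unop =
      hatMk S _ B.unop U ≫ counitApp S F B.unop ≫ F.map i
    rw [← Category.assoc, hatMk_hatRestrict, hatMk_counitApp, ← Category.assoc, hatMk_counitApp]
    ext s
    exact (res_nuEval (leOfHom i.unop) _ s).symm

variable [ProperSpace X] (D : Delone.DeloneSet X)

/-- A section near A^ν is defined near U^ν for some coarse neighbourhood U of A. Likewise two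
sections that agree near A^ν agree near some V^ν. -/
theorem hatSheaf_isReflective (G : TopCat.Sheaf AddCommGrpCat.{u} (TopCat.of (Corona D.carrier))) :
    IsReflective ((hatSheaf D.carrier (hatPresheaf_isSheaf D)).obj G) := by
  refine (isReflective_iff _).2 fun A => ⟨fun x => ?_, fun U y y' h => ?_⟩
  · obtain ⟨P, hP, s, rfl⟩ := exists_germ D G.obj x
    obtain ⟨U, hU, hUP⟩ := exists_basicClosed_subset_basicOpen_le D hP
    refine ⟨⟨U, hU⟩, germ D G.obj hUP s, (coarseRestrict_eq_iff _).2 ?_⟩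
    exact (res_germ D G.obj _ _ s).trans (res_germ D G.obj _ _ s).symm
  · obtain ⟨P, hP, s, rfl⟩ := exists_germ D G.obj y
    obtain ⟨Q, hQ, t, rfl⟩ := exists_germ D G.obj y'
    have h1 := ((coarseRestrict_eq_iff _).1 h).trans ((coarseRestrict_eq_iff _).1 rfl).symm
    have h2 := (res_germ D G.obj _ hP s).symm.trans (h1.trans (res_germ D G.obj _ hQ t))
    have h3 := (germ_eq_iff D G).1 h2
    -- The germs were compared on A ∩ U only, but this set has the same points at infinity as A.
    rw [basicClosed_inter_eq D U.2] at h3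
    obtain ⟨V, hV, hVst⟩ := exists_basicClosed_subset_basicOpen_le D
      (p := ⟨{z | LocEq G.obj s t z}, isOpen_locEq s t⟩) h3
    obtain ⟨W, hWU, hWV⟩ := directed_of (· ≥ ·) U ⟨V, hV⟩
    refine ⟨W, hWU, ?_⟩
    refine (res_germ D G.obj _ hP s).trans (Eq.trans ?_ (res_germ D G.obj _ hQ t).symm)
    exact (germ_eq_iff D G).2 fun z hz => hVst (basicClosed_mono _ hWV hz)

/-- The map from `G` to `(Ĝ)^ν` that takes a section to the family of its germs. -/
noncomputable def unitMap (G : TopCat.Presheaf AddCommGrpCat.{u} (TopCat.of (Corona D.carrier))) :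
    G ⟶ (nuPresheaf D.carrier).obj ((hatPresheaf D.carrier).obj G) where
  app p := AddCommGrpCat.ofHom
    { toFun := fun s => nuMk (fun A hA => germ D G ((inner_iff D).1 hA) s)
        fun A B h hB => res_germ D G h ((inner_iff D).1 hB) s
      map_zero' := nu_ext fun A hA => map_zero (germ D G ((inner_iff D).1 hA)).hom
      map_add' := fun s t => nu_ext fun A hA => map_add (germ D G ((inner_iff D).1 hA)).hom s t }
  naturality p p' i := by
    ext s
    exact nu_ext fun A hA => germ_res D G ((inner_iff D).1 hA) (leOfHom i.unop) s

theorem nuEval_unitMap (G : TopCat.Presheaf AddCommGrpCat.{u} (TopCat.of (Corona D.carrier)))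
    {p : Opens (Corona D.carrier)} {A : Set X} (hA : Inner D.carrier p A) (s : G.obj (op p)) :
    nuEval _ hA ((unitMap D G).app (op p) s) = germ D G ((inner_iff D).1 hA) s :=
  rfl

theorem counitMap_germ (F : (Set X)ᵒᵖ ⥤ AddCommGrpCat.{u}) {A : Set X}
    {P : Opens (Corona D.carrier)} (hP : basicClosed D.carrier A ⊆ P)
    (s : ((nuPresheaf D.carrier).obj F).obj (op P)) :
    (counitMap D.carrier F).app (op A) (germ D _ hP s) = nuEval F ((inner_iff D).2 hP) s := by
  obtain ⟨U, hU⟩ := exists_coarseNhd_basicOpen_le D hP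
  rw [germ_eq_hatMk D _ hP U hU]
  exact ConcreteCategory.congr_hom (hatMk_counitApp D.carrier F A U) _

/-- The sets O_C with C^ν ⊆ p cover p, and the germ along C^ν determines a section at the points of
O_C. Conversely, representatives of a compatible family of germs can be glued along the sets O_C,
since O_C ∩ O_E ⊆ (C ∩ E)^ν. -/
theorem isIso_unitMap (G : TopCat.Sheaf AddCommGrpCat.{u} (TopCat.of (Corona D.carrier))) :
    IsIso (unitMap D G.obj) := by
  refine (NatTrans.isIso_iff_isIso_app _).2 fun p => ?_
  induction p using Opposite.rec with | op p => ?_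
  refine (ConcreteCategory.isIso_iff_bijective _).2 ⟨fun s t hst => ?_, fun x => ?_⟩
  · refine eq_of_forall_locEq G fun z hz => ?_
    obtain ⟨C, hzC, hC⟩ := exists_mem_basicOpen_and_basicClosed_subset D hz
    exact (germ_eq_iff D G (hP := hC) (hQ := hC)).1 (congrArg (nuEval _ ((inner_iff D).2 hC)) hst) z
      (basicOpen_subset_basicClosed D _ hzC)
  · choose Q hQ s hs using fun A (hA : Inner D.carrier p A) =>
      exists_germ D G.obj (nuEval _ hA x)
    have hloc : ∀ A (hA : Inner D.carrier p A) B (hB : Inner D.carrier p B),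
        ∀ z ∈ basicClosed D.carrier (A ∩ B), LocEq G.obj (s A hA) (s B hB) z := by
      intro A hA B hB
      refine (germ_eq_iff D G (hP := (basicClosed_mono _ Set.inter_subset_left).trans (hQ A hA))
        (hQ := (basicClosed_mono _ Set.inter_subset_right).trans (hQ B hB))).1 ?_
      rw [← res_germ D G.obj Set.inter_subset_left (hQ A hA),
        ← res_germ D G.obj Set.inter_subset_right (hQ B hB), hs, hs, res_nuEval, res_nuEval]
    let J := {C : Set X // Inner D.carrier p C}
    obtain ⟨t, ht⟩ := exists_glue G (p := fun C : J => basicOpen D.carrier C.1)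
      (Q := fun C : J => Q C.1 C.2)
      (fun C => (basicOpen_subset_basicClosed D _).trans (hQ C.1 C.2)) (fun C => s C.1 C.2)
      fun C E z hC hE => hloc C.1 C.2 E.1 E.2 z
        (basicClosed_inter_basicOpen_subset (basicOpen_subset_basicClosed D _ hC) hE)
    have hp : ∀ z ∈ p, ∃ C : J, z ∈ basicOpen D.carrier C.1 := by
      intro z hz
      obtain ⟨C, hzC, hC⟩ := exists_mem_basicOpen_and_basicClosed_subset D hz
      exact ⟨⟨C, (inner_iff D).2 hC⟩, hzC⟩
    have hle : p ≤ ⨆ C : J, basicOpen D.carrier C.1 := fun z hz => Opens.mem_iSup.2 (hp z hz)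
    refine ⟨res G.obj hle t, nu_ext fun A hA => ?_⟩
    refine (nuEval_unitMap D G.obj hA _).trans (Eq.trans ?_ (hs A hA))
    refine (germ_eq_iff D G).2 fun z hz => ?_
    have hzp := (inner_iff D).1 hA hz
    obtain ⟨C, hC⟩ := hp z hzp
    exact (locEq_res hle t hzp).trans ((ht C z hC).trans
      (hloc A hA C.1 C.2 z (basicClosed_inter_basicOpen_subset hz hC)).symm)

theorem isIso_counitMap (F : CoarseSheaf X) (hF : IsReflective F) :
    IsIso (counitMap D.carrier F.obj) := by
  rw [isReflective_iff] at hF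
  refine (NatTrans.isIso_iff_isIso_app _).2 fun A => ?_
  induction A using Opposite.rec with | op A => ?_
  refine (ConcreteCategory.isIso_iff_bijective _).2
    ⟨(injective_iff_map_eq_zero ((counitMap D.carrier F.obj).app (op A)).hom).2 fun x hx => ?_,
      fun x => ?_⟩
  · obtain ⟨P, hP, s, rfl⟩ := exists_germ D _ x
    replace hx := (counitMap_germ D F.obj hP s).symm.trans hx
    obtain ⟨U, hU, hUP⟩ := exists_basicClosed_subset_basicOpen_le D hP
    have hUi : Inner D.carrier P U := (inner_iff D).2 hUP
    -- Reflectivity spreads the vanishing of the component at A to a coarse neighbourhood V. Sets B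
    -- with B^ν ⊆ O_V lie in V up to a bounded set, so all components of s over O_V vanish.
    obtain ⟨V, hV, hV'⟩ := (hF A).2 ⟨U, hU⟩ (nuEval F.obj hUi s) 0 (by
      rw [map_zero, coarseRestrict_eq_iff, res_nuEval, map_zero]
      have h1 := congrArg (res F.obj (Set.inter_subset_left : A ∩ U ⊆ A)) hx
      rwa [res_nuEval, map_zero] at h1)
    rw [res_nuEval, map_zero] at hV'
    have hVP : basicOpen D.carrier V.1 ≤ P := (basicOpen_subset_basicClosed D _).trans
      ((basicClosed_mono _ hV).trans hUP)
    have hs : res ((nuPresheaf D.carrier).obj F.obj) hVP s = 0 := by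
      refine nu_ext fun B hB => ?_
      have hBV := (inner_basicOpen_iff D _ _).1 hB
      refine res_injective_of_isBounded F (Set.inter_subset_left : B ∩ V.1 ⊆ B) ?_ ?_
      · rw [Set.sdiff_self_inter, Set.sdiff_eq]
        exact isBounded_inter hBV
      · rw [map_zero, map_zero, nuEval_res, res_nuEval]
        have h1 := congrArg (res F.obj (Set.inter_subset_right : B ∩ V.1 ⊆ V.1)) hV'
        rwa [res_nuEval, map_zero] at h1
    rw [← germ_res D _ ((basicClosed_subset_basicOpen_iff D).2 V.2) hVP, hs, map_zero]
  · obtain ⟨U, y, rfl⟩ := (hF A).1 x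
    -- An extension y ∈ F(U) of x defines a section over O_U through its coarse restrictions, and
    -- the component of this section at A is x.
    let s : ((nuPresheaf D.carrier).obj F.obj).obj (op (basicOpen D.carrier U.1)) :=
      nuMk (fun B hB => coarseRestrict F B ⟨U.1, (inner_basicOpen_iff D _ _).1 hB⟩ y)
        fun B C h hC => res_coarseRestrict F h ⟨U.1, (inner_basicOpen_iff D _ _).1 hC⟩ y
    exact ⟨germ D _ ((basicClosed_subset_basicOpen_iff D).2 U.2) s, counitMap_germ D F.obj _ s⟩

theorem hat_nu_hom_ext {F : (Set X)ᵒᵖ ⥤ AddCommGrpCat.{u}}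
    {G : TopCat.Presheaf AddCommGrpCat.{u} (TopCat.of (Corona D.carrier))}
    {f g : (hatPresheaf D.carrier).obj G ⟶ F}
    (h : ∀ (A : Set X) (P : Opens (Corona D.carrier)) (hP : basicClosed D.carrier A ⊆ P)
      (s : G.obj (op P)), f.app (op A) (germ D G hP s) = g.app (op A) (germ D G hP s)) :
    f = g := by
  ext A x
  obtain ⟨P, hP, s, rfl⟩ := exists_germ D G (A := A.unop) x
  exact h _ _ _ _

theorem hatPresheaf_map_germ
    {G G' : TopCat.Presheaf AddCommGrpCat.{u} (TopCat.of (Corona D.carrier))} (β : G ⟶ G')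
    {A : Set X} {P : Opens (Corona D.carrier)} (hP : basicClosed D.carrier A ⊆ P)
    (s : G.obj (op P)) :
    ((hatPresheaf D.carrier).map β).app (op A) (germ D G hP s) =
      germ D G' hP (β.app (op P) s) := by
  obtain ⟨U, hU⟩ := exists_coarseNhd_basicOpen_le D hP
  rw [germ_eq_hatMk D G hP U hU, germ_eq_hatMk D G' hP U hU]
  refine (ConcreteCategory.congr_hom (hatMk_hatMap D.carrier β A U) _).trans ?_
  exact congrArg _ (ConcreteCategory.congr_hom (β.naturality (homOfLE hU).op) s)

/-- The hat functor on sheaves is left adjoint to `F ↦ F^ν`. -/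
noncomputable def hatNuAdjunction :
    hatSheaf D.carrier (hatPresheaf_isSheaf D) ⊣ nuSheaf D.carrier (nuPresheaf_isSheaf D) :=
  Adjunction.mkOfUnitCounit
    { unit :=
        { app := fun G => ⟨unitMap D G.obj⟩
          naturality := fun G G' β => ObjectProperty.hom_ext _ (NatTrans.ext (funext fun p =>
            AddCommGrpCat.hom_ext (AddMonoidHom.ext fun s => nu_ext fun A hA =>
              (hatPresheaf_map_germ D β.hom ((inner_iff D).1 hA) s).symm))) }
      counit :=
        { app := fun F => ⟨counitMap D.carrier F.obj⟩
          naturality := fun F F' φ => ObjectProperty.hom_ext _ (hat_nu_hom_ext D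
            fun A P hP s => by
              refine (congrArg ((counitMap D.carrier F'.obj).app (op A))
                (hatPresheaf_map_germ D ((nuPresheaf D.carrier).map φ.hom) hP s)).trans ?_
              refine (counitMap_germ D F'.obj hP _).trans ?_
              exact (congrArg (φ.hom.app (op A)) (counitMap_germ D F.obj hP s)).symm) }
      -- Both triangle identities say that forming the germs of a section and then taking the
      -- component at A gives back what was there at A.
      left_triangle := by
        ext G : 2
        refine ObjectProperty.hom_ext _ (hat_nu_hom_ext D fun A P hP s => ?_)
        refine (congrArg ((counitMap D.carrier ((hatPresheaf D.carrier).obj G.obj)).app (op A))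
          (hatPresheaf_map_germ D (unitMap D G.obj) hP s)).trans ?_
        exact counitMap_germ D _ hP _
      right_triangle := by
        ext F : 2
        exact ObjectProperty.hom_ext _ (NatTrans.ext (funext fun p =>
          AddCommGrpCat.hom_ext (AddMonoidHom.ext fun s => nu_ext fun A hA =>
            counitMap_germ D F.obj ((inner_iff D).1 hA) s))) }

instance isIso_hatNuAdjunction_unit : IsIso (hatNuAdjunction D).unit := by
  refine (NatTrans.isIso_iff_isIso_app _).2 fun G => ?_
  have : IsIso ((sheafToPresheaf _ _).map ((hatNuAdjunction D).unit.app G)) := isIso_unitMap D G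
  exact (fullyFaithfulSheafToPresheaf _ _).isIso_of_isIso_map _

theorem isIso_hatNuAdjunction_counit_app (F : CoarseSheaf X) (hF : IsReflective F) :
    IsIso ((hatNuAdjunction D).counit.app F) := by
  have : IsIso ((sheafToPresheaf _ _).map ((hatNuAdjunction D).counit.app F)) :=
    isIso_counitMap D F hF
  exact (fullyFaithfulSheafToPresheaf _ _).isIso_of_isIso_map _

/-- On reflective sheaves the counit is an isomorphism. -/
noncomputable def reflectiveCounitIso :
    (((IsReflective (X := X)).ι ⋙ nuSheaf D.carrier (nuPresheaf_isSheaf D)) ⋙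
      (IsReflective (X := X)).lift (hatSheaf D.carrier (hatPresheaf_isSheaf D))
        (hatSheaf_isReflective D)) ⋙
        (IsReflective (X := X)).ι ≅ 𝟭 _ ⋙ (IsReflective (X := X)).ι :=
  NatIso.ofComponents
    (fun F =>
      have := isIso_hatNuAdjunction_counit_app D F.obj F.property
      asIso ((hatNuAdjunction D).counit.app F.obj))
    fun φ => (hatNuAdjunction D).counit.naturality φ.hom

/-- Reflective sheaves on `X_ct` are equivalent to sheaves on the Higson corona. -/
noncomputable def reflectiveEquivalence :
    (IsReflective (X := X)).FullSubcategory ≌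
      TopCat.Sheaf AddCommGrpCat.{u} (TopCat.of (Corona D.carrier)) :=
  CategoryTheory.Equivalence.mk
    ((IsReflective (X := X)).ι ⋙ nuSheaf D.carrier (nuPresheaf_isSheaf D))
    ((IsReflective (X := X)).lift (hatSheaf D.carrier (hatPresheaf_isSheaf D))
        (hatSheaf_isReflective D))
    (Functor.fullyFaithfulCancelRight (IsReflective (X := X)).ι (reflectiveCounitIso D)).symm
    (asIso (hatNuAdjunction D).unit).symm

/-- The global sections of `F^ν` are the sections of `F` over the whole space. -/
noncomputable def nuSheafGlobalSections :
    nuSheaf D.carrier (nuPresheaf_isSheaf D) ⋙ (sheafSections _ _).obj (op ⊤) ≅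
      (sheafSections (coarseTopology X) AddCommGrpCat.{u}).obj (op Set.univ) :=
  -- Over ⊤ every subset is an index, so the limit is evaluation at the largest one, X itself.
  have h : ∀ A, Inner D.carrier ⊤ A := fun A => (inner_iff D).2 (Set.subset_univ _)
  NatIso.ofComponents
    (fun F => by
      have : IsIso (nuEval F.obj (h Set.univ)) := by
        refine (ConcreteCategory.isIso_iff_bijective _).2 ⟨fun s t hst => ?_, fun x => ?_⟩
        · refine nu_ext fun A hA => ?_
          rw [← res_nuEval (Set.subset_univ A) (h _) s, hst, res_nuEval]
        · refine ⟨nuMk (fun A _ => res F.obj (Set.subset_univ A) x)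
            fun A B hAB _ => res_res _ _ _ _, ?_⟩
          exact res_rfl F.obj x
      exact @asIso _ _ _ _ (nuEval F.obj (h Set.univ)) this)
    fun _ => rfl

/-- The hat of the constant sheaf on the Higson corona is the constant sheaf on `X_ct`. -/
noncomputable def constantSheafHatIso :
    constantSheaf (Opens.grothendieckTopology (TopCat.of (Corona D.carrier)))
        AddCommGrpCat.{u} ⋙ hatSheaf D.carrier (hatPresheaf_isSheaf D) ≅
      constantSheaf (coarseTopology X) AddCommGrpCat.{u} :=
  -- The composite adjunction has right adjoint F ↦ F^ν(ν(X)) ≅ F(X), and constant sheaves on X_ct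
  -- are also left adjoint to F ↦ F(X).
  (((constantSheafAdj _ _ isTerminalTop).comp (hatNuAdjunction D)).ofNatIsoRight
    (nuSheafGlobalSections D)).leftAdjointUniq
      (constantSheafAdj (coarseTopology X) AddCommGrpCat.{u} (T := Set.univ) isTerminalTop)

end Adjunction

end HigsonCorona

open HigsonCorona in
theorem mainTheorem7 {X : Type u} [MetricSpace X] [ProperSpace X] (D : Delone.DeloneSet X) :
    ∃ (hν : ∀ F : CoarseSheaf X,
        TopCat.Presheaf.IsSheaf ((nuPresheaf D.carrier).obj F.obj))
      (hhat : ∀ G : TopCat.Sheaf AddCommGrpCat.{u} (TopCat.of (Corona D.carrier)),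
        Presheaf.IsSheaf (coarseTopology X) ((hatPresheaf D.carrier).obj G.obj))
      (hrefl : ∀ G : TopCat.Sheaf AddCommGrpCat.{u} (TopCat.of (Corona D.carrier)),
        IsReflective ((hatSheaf D.carrier hhat).obj G)),
      (∃ e : IsReflective.FullSubcategory ≌
            TopCat.Sheaf AddCommGrpCat.{u} (TopCat.of (Corona D.carrier)),
          e.functor = (IsReflective (X := X)).ι ⋙ nuSheaf D.carrier hν ∧
          e.inverse = IsReflective.lift (hatSheaf D.carrier hhat) hrefl) ∧
      ∀ A : AddCommGrpCat.{u},
        IsReflective (constantCoarseSheaf X A) ∧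
        Nonempty ((nuSheaf D.carrier hν).obj (constantCoarseSheaf X A) ≅
          constantTopSheaf (TopCat.of (Corona D.carrier)) A) ∧
        Nonempty ((hatSheaf D.carrier hhat).obj
          (constantTopSheaf (TopCat.of (Corona D.carrier)) A) ≅ constantCoarseSheaf X A) := by
  refine ⟨nuPresheaf_isSheaf D, hatPresheaf_isSheaf D, hatSheaf_isReflective D,
    ⟨reflectiveEquivalence D, rfl, rfl⟩, fun A => ?_⟩
  have e : (hatSheaf D.carrier (hatPresheaf_isSheaf D)).obj
      (constantTopSheaf (TopCat.of (Corona D.carrier)) A) ≅ constantCoarseSheaf X A :=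
    (constantSheafHatIso D).app A
  -- The sheaf A_X is reflective because it is isomorphic to a hat; applying ν to this isomorphism
  -- and inverting the unit yields the remaining one.
  refine ⟨isReflective_of_iso e (hatSheaf_isReflective D _), ⟨?_⟩, ⟨e⟩⟩
  exact (nuSheaf D.carrier (nuPresheaf_isSheaf D)).mapIso e.symm ≪≫
    ((asIso (hatNuAdjunction D).unit).app _).symm
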